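/- Let $d\ge 1$. For a finite Borel measure $\mu$ on $\mathbb{R}^d$ write $\widehat\mu(z)=\int e^{-2\pi i\langle x,z\rangle}\,d\mu(x)$ and, for $\theta\in(0,1]$ and $s\in\mathbb{R}$, $$\mathcal{J}_{s,\theta}(\mu)=\Big(\int_{\mathbb{R}^d}|\widehat\mu(z)|^{2/\theta}|z|^{s/\theta-d}\,dz\Big)^{\theta}\in[0,\infty],$$ $$\dim^\theta_{\mathrm F}\mu=\sup\{s\ge 0:\mathcal{J}_{s,\theta}(\mu)<\infty\}\in[0,\infty]\quad(\sup\emptyset=0),$$ $$\dim_{\mathrm F}\mu=\sup\{s\ge 0:\ \exists c>0\ \ \forall z\in\mathbb{R}^d\quad |\widehat\mu(z)|\le c|z|^{-s/2}\}\in[0,\infty],$$ where a negative power of $0$ is $\infty$. Let $R>0$ and $0<\alpha<1/R$. (i) For every $s>0$ there is a constant $0<C<\infty$, depending only on $d,s,\alpha,R$, such that for every finite Borel measure $\mu$ on $\mathbb{R}^d$ with compact support of diameter $R$ and every $\theta\in(0,1]$, $$C^{-1}\,\mathcal{J}_{s,\theta}(\mu)\ \le\ \Big(|\widehat\mu(0)|^{2/\theta}+\sum_{z\in\alpha\mathbb{Z}^d\setminus\{0\}}|\widehat\mu(z)|^{2/\theta}|z|^{s/\theta-d}\Big)^{\theta}\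 \le\ C\,\mathcal{J}_{s,\theta}(\mu)$$ (in particular, both quantities are finite or both are infinite). (ii) For every finite Borel measure $\mu$ on $\mathbb{R}^d$ with compact support of diameter $R$ and every $\theta\in(0,1]$, $$\dim^\theta_{\mathrm F}\mu=\sup\Big\{s\in\mathbb{R}:\sum_{z\in\alpha\mathbb{Z}^d\setminus\{0\}}|\widehat\mu(z)|^{2/\theta}|z|^{s/\theta-d}<\infty\Big\}.$$ (iii) For every such $\mu$, $$\dim_{\mathrm F}\mu=\sup\Big\{s\in\mathbb{R}:\sup_{z\in\alpha\mathbb{Z}^d}|\widehat\mu(z)|^2|z|^s<\infty\Big\}.$$ -/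

import Mathlib

open MeasureTheory
open scoped ENNReal NNReal

noncomputable section

/-- The Fourier transform of a finite measure on `ℝ^d`:
`μ̂(z) = ∫ exp (-2πi ⟨x, z⟩) dμ(x)`. -/
def measureFourier {d : ℕ} (μ : Measure (EuclideanSpace ℝ (Fin d)))
    (z : EuclideanSpace ℝ (Fin d)) : ℂ :=
  ∫ x, Complex.exp (-(2 * (Real.pi : ℂ) * Complex.I * ((inner ℝ x z : ℝ) : ℂ))) ∂μ

/-- The `(s, θ)`-energy (for `θ ∈ (0, 1]`)
`𝒥_{s,θ}(μ) = (∫ |μ̂(z)|^(2/θ) |z|^(s/θ - d) dz)^θ`, with values in `[0, ∞]`. -/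
def fourierEnergy {d : ℕ} (s θ : ℝ) (μ : Measure (EuclideanSpace ℝ (Fin d))) : ℝ≥0∞ :=
  (∫⁻ z, ‖measureFourier μ z‖ₑ ^ (2 / θ) * ‖z‖ₑ ^ (s / θ - (d : ℝ))) ^ θ

/-- The Fourier spectrum of `μ` at `θ ∈ (0, 1]`: the supremum of the `s ≥ 0` such that
`𝒥_{s,θ}(μ) < ∞`. It is taken in `[0, ∞]`, so that it is `0` if there is no such `s`. -/
def fourierSpectrum {d : ℕ} (θ : ℝ) (μ : Measure (EuclideanSpace ℝ (Fin d))) : ℝ≥0∞ :=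
  ⨆ (s : ℝ≥0) (_ : fourierEnergy (s : ℝ) θ μ < ∞), (s : ℝ≥0∞)

/-- The Fourier dimension of `μ`: the supremum in `[0, ∞]` of the `s ≥ 0` such that
`|μ̂(z)| ≤ c |z|^(-s/2)` for some constant `c` and all `z`. In `[0, ∞]` a negative power of `0`
is `∞`, so that for `s > 0` nothing is required at `z = 0`. -/
def fourierDimension {d : ℕ} (μ : Measure (EuclideanSpace ℝ (Fin d))) : ℝ≥0∞ :=
  ⨆ (s : ℝ≥0) (_ : ∃ c : ℝ≥0, 0 < c ∧ ∀ z : EuclideanSpace ℝ (Fin d),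
    ‖measureFourier μ z‖ₑ ≤ (c : ℝ≥0∞) * ‖z‖ₑ ^ (-((s : ℝ) / 2))), (s : ℝ≥0∞)

/-- The scaled lattice `α ℤ^d`. -/
def scaledLattice (d : ℕ) (α : ℝ) : Set (EuclideanSpace ℝ (Fin d)) :=
  Set.range fun k : Fin d → ℤ => WithLp.toLp 2 fun i => α * (k i : ℝ)

/-- The sum over `z ∈ α ℤ^d ∖ {0}` of `|μ̂(z)|^(2/θ) |z|^(s/θ - d)`, in `[0, ∞]`. -/
def latticeSum {d : ℕ} (α s θ : ℝ) (μ : Measure (EuclideanSpace ℝ (Fin d))) : ℝ≥0∞ :=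
  ∑' z : ↥(scaledLattice d α \ {0}),
    ‖measureFourier μ (z : EuclideanSpace ℝ (Fin d))‖ₑ ^ (2 / θ) *
      ‖(z : EuclideanSpace ℝ (Fin d))‖ₑ ^ (s / θ - (d : ℝ))

/-- The discrete energy `(|μ̂(0)|^(2/θ) + ∑_{z ∈ α ℤ^d ∖ {0}} |μ̂(z)|^(2/θ) |z|^(s/θ - d))^θ`. -/
def latticeEnergy {d : ℕ} (α s θ : ℝ) (μ : Measure (EuclideanSpace ℝ (Fin d))) : ℝ≥0∞ :=
  (‖measureFourier μ 0‖ₑ ^ (2 / θ) + latticeSum α s θ μ) ^ θ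

end

/-! The mechanism is oversampling. A set of diameter `R` lies in a cube of side `R`, and translating
`μ` only changes the phase of its transform, so the cube may be centred at the origin. Since `αR <
1`, there is a smooth bump `φ` equal to 1 on `[-αR/2, αR/2]` and supported in `[-1/2, 1/2]`. For
`|x| ≤ R/2` the character `t ↦ exp(-2πixt)` is then reproduced by convolution with a rescaled
transform of `φ`, both over the line (Fourier inversion) and over `αℤ` (Poisson summation, where
only the zeroth translate of the bump is seen). Taking products over coordinates and integrating
against `μ` dominates `|μ̂|` pointwise by its averages over `ℝ^d` and over `αℤ^d`, with a kernel of
arbitrarily fast decay (`exists_productKernel_domination`).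

Put `q = 1/θ`. A weighted Schur test (`lintegral_weighted_le_of_le_lintegral`) turns each domination
into an inequality with weight `(1+|z|)^(sq-d)` and exponent `2q`. The weight is split as `(s/2)(2q)
- d`, so that only the fixed moment `s/2 + d` of the kernel enters and the constant is a `q`-th
power. Taking `θ`-th powers makes it independent of `θ`.

The homogeneous weight `|z|^(sq-d)` is comparable with this one away from 0, again up to `q`-th
powers. Near 0 it is integrable because `s > 0`, so that part is controlled by the mass `|μ̂(0)|`;
conversely `|μ̂| ≥ |μ̂(0)|/2` near 0, so the energy controls the mass.

The spectrum formula follows from the comparison for `s > 0` and the trivial convergence of the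
lattice sum for `s < 0`. The Fourier dimension uses the `L^∞` endpoint of the Schur test. -/

/-- The inhomogeneous weight `1 + ‖z‖`, with values in `[1, ∞)`. -/
noncomputable def enormWeight {E : Type*} [NormedAddCommGroup E] (z : E) : ℝ≥0∞ := 1 + ‖z‖ₑ

/-! ### Submultiplicativity of the weight -/

section Weight

variable {E : Type*} [NormedAddCommGroup E]

lemma one_le_enormWeight (z : E) : 1 ≤ enormWeight z := le_self_add

lemma enormWeight_ne_zero (z : E) : enormWeight z ≠ 0 :=
  (zero_lt_one.trans_le (one_le_enormWeight z)).ne'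

lemma enormWeight_ne_top (z : E) : enormWeight z ≠ ∞ := by simp [enormWeight]

lemma enormWeight_sub_comm (z w : E) : enormWeight (z - w) = enormWeight (w - z) := by
  simp only [enormWeight, ← ofReal_norm, norm_sub_rev]

@[fun_prop]
lemma measurable_enormWeight [MeasurableSpace E] [OpensMeasurableSpace E] :
    Measurable (enormWeight : E → ℝ≥0∞) := by
  unfold enormWeight; fun_prop

lemma enormWeight_le_mul (z w : E) : enormWeight z ≤ enormWeight w * enormWeight (z - w) := by
  have h : ‖z‖ₑ ≤ ‖w‖ₑ + ‖z - w‖ₑ := by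
    simpa using enorm_add_le w (z - w)
  calc enormWeight z ≤ 1 + (‖w‖ₑ + ‖z - w‖ₑ) := by unfold enormWeight; gcongr
    _ ≤ 1 + (‖w‖ₑ + ‖z - w‖ₑ) + ‖w‖ₑ * ‖z - w‖ₑ := le_self_add
    _ = enormWeight w * enormWeight (z - w) := by unfold enormWeight; ring

/-- Comparability within a factor `c` survives powers of either sign. This matters because `s/θ - d`
has no fixed sign. -/
lemma rpow_le_rpow_mul_rpow_abs {a b c : ℝ≥0∞} (hb : b ≠ ∞) (hc : 1 ≤ c) (hc' : c ≠ ∞)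
    (hab : a ≤ b * c) (hba : b ≤ a * c) (e : ℝ) : a ^ e ≤ b ^ e * c ^ |e| := by
  have hc0 : c ≠ 0 := (zero_lt_one.trans_le hc).ne'
  rcases le_total 0 e with he | he
  · rw [abs_of_nonneg he, ← ENNReal.mul_rpow_of_nonneg _ _ he]
    gcongr
  · rw [abs_of_nonpos he]
    have h1 : b ^ (-e) ≤ a ^ (-e) * c ^ (-e) := by
      rw [← ENNReal.mul_rpow_of_nonneg _ _ (by linarith)]
      exact ENNReal.rpow_le_rpow hba (by linarith)
    rcases eq_or_ne b 0 with rfl | hb0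
    · rcases eq_or_lt_of_le he with rfl | he
      · simp
      · simp [ENNReal.zero_rpow_of_neg he, hc0, hc']
    have hb1 : b ^ (-e) ≠ 0 := by simp [hb0, hb]
    have hb2 : b ^ (-e) ≠ ∞ := ENNReal.rpow_ne_top_of_nonneg (by linarith) hb
    have ha0 : a ≠ 0 := by rintro rfl; simp_all
    have hainv : a ^ e = (a ^ (-e))⁻¹ := by rw [ENNReal.rpow_neg, inv_inv]
    have hbinv : b ^ e = (b ^ (-e))⁻¹ := by rw [ENNReal.rpow_neg, inv_inv]
    rw [hainv, hbinv, ENNReal.inv_le_iff_inv_le, ENNReal.mul_inv, inv_inv]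
    · rw [← div_eq_mul_inv]
      exact ENNReal.div_le_of_le_mul h1
    · exact Or.inr (ENNReal.rpow_ne_top_of_nonneg (by linarith) hc')
    · exact Or.inr (by simp [hc0, hc'])

/-- Peetre's inequality: it moves a weight from one side of a kernel to the other at the cost of a
moment of the kernel. -/
lemma enormWeight_rpow_le (z w : E) (e : ℝ) :
    enormWeight z ^ e ≤ enormWeight w ^ e * enormWeight (z - w) ^ |e| :=
  rpow_le_rpow_mul_rpow_abs (enormWeight_ne_top w) (one_le_enormWeight _) (enormWeight_ne_top _)
    (enormWeight_le_mul z w) (by rw [enormWeight_sub_comm]; exact enormWeight_le_mul w z) e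

end Weight

/-! ### Coordinatewise bounds and product measures -/

lemma one_add_sum_le_prod {ι : Type*} (s : Finset ι) (x : ι → ℝ≥0∞) :
    1 + ∑ i ∈ s, x i ≤ ∏ i ∈ s, (1 + x i) := by
  classical
  induction s using Finset.induction_on with
  | empty => simp
  | insert i s hi ih =>
    rw [Finset.sum_insert hi, Finset.prod_insert hi]
    calc 1 + (x i + ∑ j ∈ s, x j) ≤ 1 + (x i + ∑ j ∈ s, x j) + x i * ∑ j ∈ s, x j := le_self_add
      _ = (1 + x i) * (1 + ∑ j ∈ s, x j) := by ring
      _ ≤ _ := by gcongr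

lemma enorm_le_sum_enorm {d : ℕ} (u : EuclideanSpace ℝ (Fin d)) : ‖u‖ₑ ≤ ∑ i, ‖u i‖ₑ := by
  have h : ‖u‖ ≤ ∑ i, ‖u i‖ := by
    rw [EuclideanSpace.norm_eq]
    exact Real.sqrt_le_iff.mpr ⟨by positivity, Finset.sum_sq_le_sq_sum_of_nonneg (by simp)⟩
  simp only [← ofReal_norm]
  rw [← ENNReal.ofReal_sum_of_nonneg (by simp)]
  exact ENNReal.ofReal_le_ofReal h

lemma enormWeight_le_prod {d : ℕ} (u : EuclideanSpace ℝ (Fin d)) :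
    enormWeight u ≤ ∏ i, enormWeight (u i) :=
  (add_le_add_right (enorm_le_sum_enorm u) 1).trans (one_add_sum_le_prod _ _)

lemma enormWeight_apply_le {d : ℕ} (u : EuclideanSpace ℝ (Fin d)) (i : Fin d) :
    enormWeight (u i) ≤ enormWeight u := by
  unfold enormWeight
  gcongr
  simp only [← ofReal_norm]
  exact ENNReal.ofReal_le_ofReal (PiLp.norm_apply_le u i)

theorem lintegral_pi_prod_eq_prod_lintegral {Ω : Type*} [MeasurableSpace Ω] (ν : Measure Ω)
    [SigmaFinite ν] {n : ℕ} (h : Fin n → Ω → ℝ≥0∞) (hh : ∀ i, Measurable (h i)) :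
    ∫⁻ ω, ∏ i, h i (ω i) ∂(Measure.pi fun _ : Fin n => ν) = ∏ i, ∫⁻ ω, h i ω ∂ν := by
  induction n with
  | zero => simp
  | succ n ih =>
    rw [← ((measurePreserving_piFinSuccAbove (fun _ : Fin (n + 1) => ν) 0).symm).lintegral_comp
      (f := fun ω => ∏ i, h i (ω i)) (by fun_prop)]
    simp only [Fin.prod_univ_succ]
    rw [← ih (fun i => h i.succ) (fun i => hh _), ← lintegral_prod_mul (hh 0).aemeasurable
      (Finset.measurable_fun_prod _
        fun i _ => (hh i.succ).comp (measurable_pi_apply i)).aemeasurable]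
    simp [MeasurableEquiv.piFinSuccAbove]

/-- Makes lattice sums integrals for a product measure, so that one argument covers both `ℝ^d` and
`αℤ^d`. -/
theorem pi_count_eq_count {ι : Type*} [Fintype ι] :
    (Measure.pi fun _ : ι => (Measure.count : Measure ℤ)) = Measure.count := by
  refine Measure.ext_of_singleton fun k => ?_
  simp [Measure.pi_singleton]

/-! ### Weighted Schur tests -/

/-- Hölder's inequality against the constant 1 for the measure `k dν`, whose mass is at most `M`;
the power of `M` is `p/p' = p - 1`. -/
theorem lintegral_mul_rpow_le {Ω : Type*} [MeasurableSpace Ω] (ν : Measure Ω) {g k : Ω → ℝ≥0∞}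
    (hg : Measurable g) (hk : Measurable k) {p : ℝ} (hp : 1 ≤ p) {M : ℝ≥0∞}
    (hM : ∫⁻ ω, k ω ∂ν ≤ M) :
    (∫⁻ ω, g ω * k ω ∂ν) ^ p ≤ M ^ (p - 1) * ∫⁻ ω, g ω ^ p * k ω ∂ν := by
  rcases hp.eq_or_lt with rfl | hp
  · simp
  have hpq := Real.HolderConjugate.conjExponent hp
  have h := ENNReal.lintegral_mul_le_Lp_mul_Lq (ν.withDensity k) hpq (f := g) (g := fun _ => 1)
    hg.aemeasurable aemeasurable_const
  have h0 : 0 < p := by linarith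
  simp only [Pi.mul_apply, mul_one, ENNReal.one_rpow] at h
  rw [lintegral_withDensity_eq_lintegral_mul _ hk hg,
    lintegral_withDensity_eq_lintegral_mul _ hk (hg.pow_const p),
    lintegral_withDensity_eq_lintegral_mul _ hk measurable_const] at h
  simp only [Pi.mul_apply, mul_one] at h
  have h2 := ENNReal.rpow_le_rpow h h0.le
  rw [ENNReal.mul_rpow_of_nonneg _ _ h0.le, ← ENNReal.rpow_mul, ← ENNReal.rpow_mul,
    one_div_mul_cancel h0.ne', ENNReal.rpow_one] at h2
  have e1 : 1 / p.conjExponent * p = p - 1 := by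
    unfold Real.conjExponent; field_simp
  rw [e1] at h2
  simp only [mul_comm (g _), mul_comm (g _ ^ p)]
  refine h2.trans ?_
  rw [mul_comm]
  gcongr

/-- A weighted Schur test: a pointwise domination of `f` along `P` by an average of `f` along `Q`
yields a weighted `L^p` domination. -/
theorem lintegral_weighted_le_of_le_lintegral {E X Y : Type*} [NormedAddCommGroup E]
    [MeasurableSpace E] [BorelSpace E] [SecondCountableTopology E]
    [MeasurableSpace X] [MeasurableSpace Y]
    (νX : Measure X) (νY : Measure Y) [SFinite νX] [SFinite νY] {P : X → E} {Q : Y → E}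
    (hP : Measurable P) (hQ : Measurable Q) {f K : E → ℝ≥0∞} (hf : Measurable f)
    (hK : Measurable K) {a b p : ℝ} (ha : 0 ≤ a) (hb : 0 ≤ b) (hp : 1 ≤ p) {M : ℝ≥0∞}
    (hfK : ∀ x, f (P x) ≤ ∫⁻ y, f (Q y) * K (P x - Q y) ∂νY)
    (hMY : ∀ z, ∫⁻ y, K (z - Q y) * enormWeight (z - Q y) ^ a ∂νY ≤ M)
    (hMX : ∀ w, ∫⁻ x, K (P x - w) * enormWeight (P x - w) ^ (a + b) ∂νX ≤ M) :
    ∫⁻ x, f (P x) ^ p * enormWeight (P x) ^ (a * p - b) ∂νX ≤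
      M ^ p * ∫⁻ y, f (Q y) ^ p * enormWeight (Q y) ^ (a * p - b) ∂νY := by
  have h0 : 0 ≤ p := by linarith
  have hW (z : E) (e e' : ℝ) : enormWeight z ^ (e + e') = enormWeight z ^ e * enormWeight z ^ e' :=
    ENNReal.rpow_add _ _ (enormWeight_ne_zero z) (enormWeight_ne_top z)
  -- The factor `a` crosses the kernel before Hölder and `-b` after it, costing moments `a` and `b`.
  -- Neither grows with `p`.
  have hsplit (z : E) : f z ^ p * enormWeight z ^ (a * p - b) =
      (f z * enormWeight z ^ a) ^ p * enormWeight z ^ (-b) := by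
    rw [sub_eq_add_neg, hW, ENNReal.mul_rpow_of_nonneg _ _ h0, ENNReal.rpow_mul, mul_assoc]
  have hpt (x : X) : f (P x) ^ p * enormWeight (P x) ^ (a * p - b) ≤
      ∫⁻ y, M ^ (p - 1) * (f (Q y) ^ p * enormWeight (Q y) ^ (a * p - b) *
        (K (P x - Q y) * enormWeight (P x - Q y) ^ (a + b))) ∂νY := by
    have h1 : f (P x) * enormWeight (P x) ^ a ≤ ∫⁻ y, (f (Q y) * enormWeight (Q y) ^ a) *
        (K (P x - Q y) * enormWeight (P x - Q y) ^ a) ∂νY := by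
      calc _ ≤ (∫⁻ y, f (Q y) * K (P x - Q y) ∂νY) * enormWeight (P x) ^ a := by
            gcongr; exact hfK x
        _ = ∫⁻ y, f (Q y) * K (P x - Q y) * enormWeight (P x) ^ a ∂νY := by
            rw [lintegral_mul_const _ (by fun_prop)]
        _ ≤ _ := by
            refine lintegral_mono fun y => ?_
            have := enormWeight_rpow_le (P x) (Q y) a
            rw [abs_of_nonneg ha] at this
            calc _ ≤ f (Q y) * K (P x - Q y) *
                  (enormWeight (Q y) ^ a * enormWeight (P x - Q y) ^ a) := by gcongr
              _ = _ := by ring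
    calc _ ≤ (∫⁻ y, (f (Q y) * enormWeight (Q y) ^ a) *
          (K (P x - Q y) * enormWeight (P x - Q y) ^ a) ∂νY) ^ p * enormWeight (P x) ^ (-b) := by
          rw [hsplit]; gcongr
      _ ≤ M ^ (p - 1) * (∫⁻ y, (f (Q y) * enormWeight (Q y) ^ a) ^ p *
          (K (P x - Q y) * enormWeight (P x - Q y) ^ a) ∂νY) * enormWeight (P x) ^ (-b) := by
          gcongr
          exact lintegral_mul_rpow_le νY (by fun_prop) (by fun_prop) hp (hMY _)
      _ = ∫⁻ y, M ^ (p - 1) * ((f (Q y) * enormWeight (Q y) ^ a) ^ p *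
          (K (P x - Q y) * enormWeight (P x - Q y) ^ a) * enormWeight (P x) ^ (-b)) ∂νY := by
          rw [mul_assoc, ← lintegral_mul_const _ (by fun_prop),
            ← lintegral_const_mul _ (by fun_prop)]
      _ ≤ _ := by
          refine lintegral_mono fun y => ?_
          gcongr M ^ (p - 1) * ?_
          have := enormWeight_rpow_le (P x) (Q y) (-b)
          rw [abs_neg, abs_of_nonneg hb] at this
          calc _ ≤ (f (Q y) * enormWeight (Q y) ^ a) ^ p *
                (K (P x - Q y) * enormWeight (P x - Q y) ^ a) *
                  (enormWeight (Q y) ^ (-b) * enormWeight (P x - Q y) ^ b) := by gcongr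
            _ = _ := by rw [hsplit, hW]; ring
  -- By Tonelli the inner integral over `x` is a moment of order `a + b`; it supplies the last
  -- factor `M`.
  calc _ ≤ ∫⁻ x, ∫⁻ y, M ^ (p - 1) * (f (Q y) ^ p * enormWeight (Q y) ^ (a * p - b) *
        (K (P x - Q y) * enormWeight (P x - Q y) ^ (a + b))) ∂νY ∂νX := lintegral_mono hpt
    _ = ∫⁻ y, ∫⁻ x, M ^ (p - 1) * (f (Q y) ^ p * enormWeight (Q y) ^ (a * p - b) *
        (K (P x - Q y) * enormWeight (P x - Q y) ^ (a + b))) ∂νX ∂νY :=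
        lintegral_lintegral_swap (by unfold Function.uncurry; fun_prop)
    _ ≤ ∫⁻ y, M ^ p * (f (Q y) ^ p * enormWeight (Q y) ^ (a * p - b)) ∂νY := by
        refine lintegral_mono fun y => ?_
        rw [lintegral_const_mul _ (by fun_prop), lintegral_const_mul _ (by fun_prop)]
        calc _ ≤ M ^ (p - 1) * (f (Q y) ^ p * enormWeight (Q y) ^ (a * p - b) * M) := by
              gcongr; exact hMX _
          _ = M ^ (p - 1) * M ^ (1 : ℝ) * (f (Q y) ^ p * enormWeight (Q y) ^ (a * p - b)) := by
              rw [ENNReal.rpow_one]; ring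
          _ = _ := by
              rw [← ENNReal.rpow_add_of_nonneg _ _ (by linarith) zero_le_one, sub_add_cancel]
    _ = _ := lintegral_const_mul _ (by fun_prop)

/-- The `L^∞` endpoint of the weighted Schur test. -/
theorem weighted_le_of_le_lintegral {E Y : Type*} [NormedAddCommGroup E]
    [MeasurableSpace E] [BorelSpace E] [SecondCountableTopology E] [MeasurableSpace Y]
    (νY : Measure Y) {Q : Y → E} (hQ : Measurable Q) {f K : E → ℝ≥0∞}
    (hK : Measurable K) {a : ℝ} (ha : 0 ≤ a) {M A : ℝ≥0∞} {z : E}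
    (hfK : f z ≤ ∫⁻ y, f (Q y) * K (z - Q y) ∂νY)
    (hMY : ∫⁻ y, K (z - Q y) * enormWeight (z - Q y) ^ a ∂νY ≤ M)
    (hA : ∀ y, f (Q y) * enormWeight (Q y) ^ a ≤ A) :
    f z * enormWeight z ^ a ≤ A * M := by
  have hfin : enormWeight z ^ a ≠ ∞ := ENNReal.rpow_ne_top_of_nonneg ha (enormWeight_ne_top z)
  calc _ ≤ (∫⁻ y, f (Q y) * K (z - Q y) ∂νY) * enormWeight z ^ a := by gcongr
    _ = ∫⁻ y, f (Q y) * K (z - Q y) * enormWeight z ^ a ∂νY :=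
        (lintegral_mul_const' _ _ hfin).symm
    _ ≤ ∫⁻ y, A * (K (z - Q y) * enormWeight (z - Q y) ^ a) ∂νY := by
        refine lintegral_mono fun y => ?_
        have := enormWeight_rpow_le z (Q y) a
        rw [abs_of_nonneg ha] at this
        calc _ ≤ f (Q y) * K (z - Q y) *
              (enormWeight (Q y) ^ a * enormWeight (z - Q y) ^ a) := by gcongr
          _ = f (Q y) * enormWeight (Q y) ^ a *
              (K (z - Q y) * enormWeight (z - Q y) ^ a) := by ring
          _ ≤ _ := by gcongr; exact hA y
    _ = A * ∫⁻ y, K (z - Q y) * enormWeight (z - Q y) ^ a ∂νY :=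
        lintegral_const_mul _ (by fun_prop)
    _ ≤ A * M := by gcongr

/-! ### Characters and one-dimensional sampling formulas -/

/-- The character `t ↦ exp (-2πit)`. -/
noncomputable def negFourierChar (t : ℝ) : ℂ :=
  Complex.exp (-(2 * (Real.pi : ℂ) * Complex.I * (t : ℂ)))

lemma negFourierChar_eq (t : ℝ) :
    negFourierChar t = Complex.exp (Complex.I * ((-(2 * Real.pi * t) : ℝ) : ℂ)) := by
  unfold negFourierChar; congr 1; push_cast; ring

lemma norm_negFourierChar (t : ℝ) : ‖negFourierChar t‖ = 1 := by
  rw [negFourierChar_eq, mul_comm, Complex.norm_exp_ofReal_mul_I]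

lemma enorm_negFourierChar (t : ℝ) : ‖negFourierChar t‖ₑ = 1 := by
  rw [← ofReal_norm, norm_negFourierChar, ENNReal.ofReal_one]

lemma negFourierChar_add (s t : ℝ) :
    negFourierChar (s + t) = negFourierChar s * negFourierChar t := by
  unfold negFourierChar; rw [← Complex.exp_add]; congr 1; push_cast; ring

lemma negFourierChar_sum {ι : Type*} (s : Finset ι) (t : ι → ℝ) :
    negFourierChar (∑ i ∈ s, t i) = ∏ i ∈ s, negFourierChar (t i) := by
  unfold negFourierChar; rw [← Complex.exp_sum]; push_cast [Finset.mul_sum, Finset.sum_neg_distrib]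
  rfl

@[fun_prop]
lemma contDiff_negFourierChar {n : WithTop ℕ∞} : ContDiff ℝ n negFourierChar := by
  have : negFourierChar = fun t : ℝ =>
      Complex.exp (-(2 * (Real.pi : ℂ) * Complex.I * Complex.ofRealCLM t)) := rfl
  rw [this]
  fun_prop

@[fun_prop]
lemma continuous_negFourierChar : Continuous negFourierChar :=
  (contDiff_negFourierChar (n := 0)).continuous

open scoped FourierTransform SchwartzMap

/-- A smooth compactly supported bump function on the line, as a complex Schwartz function. -/
noncomputable def ContDiffBump.toComplexSchwartz (φ : ContDiffBump (0 : ℝ)) : 𝓢(ℝ, ℂ) :=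
  HasCompactSupport.toSchwartzMap (f := fun x => (φ x : ℂ))
    (φ.hasCompactSupport.comp_left (g := fun y : ℝ => (y : ℂ)) (by simp))
    (Complex.ofRealCLM.contDiff.comp φ.contDiff)

lemma ContDiffBump.toComplexSchwartz_apply (φ : ContDiffBump (0 : ℝ)) (x : ℝ) :
    φ.toComplexSchwartz x = (φ x : ℂ) := rfl

/-- After substituting `v = t - w`, Fourier inversion evaluates the integral as `φ x` times the
character, and `φ x = 1`. -/
theorem integral_negFourierChar_mul_fourier_bump (φ : ContDiffBump (0 : ℝ)) {x : ℝ}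
    (hx : |x| ≤ φ.rIn) (t : ℝ) :
    ∫ w : ℝ, negFourierChar (x * w) * 𝓕 φ.toComplexSchwartz (t - w) = negFourierChar (x * t) := by
  have h1 : ∀ w : ℝ, negFourierChar (x * w) * 𝓕 φ.toComplexSchwartz (t - w) =
      (fun v : ℝ => negFourierChar (x * t) *
        (Complex.exp ((↑(2 * Real.pi * inner ℝ v x) * Complex.I)) • 𝓕 φ.toComplexSchwartz v))
        (t - w) := by
    intro w
    have : negFourierChar (x * w) = negFourierChar (x * t) *
        Complex.exp (↑(2 * Real.pi * inner ℝ (t - w) x) * Complex.I) := by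
      unfold negFourierChar
      rw [← Complex.exp_add]
      congr 1
      simp only [RCLike.inner_apply, conj_trivial]
      push_cast; ring
    simp only [smul_eq_mul, this]
    ring
  simp_rw [h1]
  rw [integral_sub_left_eq_self (fun v : ℝ => negFourierChar (x * t) *
        (Complex.exp ((↑(2 * Real.pi * inner ℝ v x) * Complex.I)) • 𝓕 φ.toComplexSchwartz v))
        volume t, integral_const_mul, ← Real.fourierInv_eq',
    ← SchwartzMap.fourierInv_coe, FourierTransform.fourierInv_fourier_eq,
    φ.toComplexSchwartz_apply, φ.one_of_mem_closedBall (by simpa using hx)]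
  simp

/-- Poisson summation for `y ↦ φ y * exp(-2πiyt)`. For `n ≠ 0` one has `|x + n| ≥ 1 - φ.rIn ≥
φ.rOut`, so only the term `n = 0` survives on the space side. -/
theorem tsum_negFourierChar_mul_fourier_bump (φ : ContDiffBump (0 : ℝ)) {x : ℝ}
    (hx : |x| ≤ φ.rIn) (hφ : φ.rIn + φ.rOut ≤ 1) (t : ℝ) :
    ∑' n : ℤ, negFourierChar (x * n) * 𝓕 φ.toComplexSchwartz (t - n) = negFourierChar (x * t) := by
  have hc : HasCompactSupport fun y => (φ y : ℂ) :=
    φ.hasCompactSupport.comp_left (g := fun y : ℝ => (y : ℂ)) (by simp)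
  let f : 𝓢(ℝ, ℂ) := HasCompactSupport.toSchwartzMap
    (f := fun y => (φ y : ℂ) * negFourierChar (y * t)) hc.mul_right
    ((Complex.ofRealCLM.contDiff.comp φ.contDiff).mul (by fun_prop))
  have hf (y : ℝ) : f y = (φ y : ℂ) * negFourierChar (y * t) := rfl
  have hfourier (n : ℤ) : 𝓕 f (n : ℝ) = 𝓕 φ.toComplexSchwartz (t + n) := by
    rw [SchwartzMap.fourier_coe, SchwartzMap.fourier_coe, Real.fourier_real_eq_integral_exp_smul,
      Real.fourier_real_eq_integral_exp_smul]
    congr 1 with v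
    rw [hf, φ.toComplexSchwartz_apply, negFourierChar, smul_eq_mul, smul_eq_mul, mul_left_comm,
      ← Complex.exp_add, mul_comm]
    congr 2
    push_cast; ring
  have hP := SchwartzMap.tsum_eq_tsum_fourier f x
  rw [tsum_eq_single 0] at hP
  · rw [← (Equiv.neg ℤ).tsum_eq]
    simp only [Int.cast_zero, add_zero, hf, hfourier, fourier_coe_apply] at hP
    rw [φ.one_of_mem_closedBall (by simpa using hx), Complex.ofReal_one, one_mul] at hP
    rw [hP]
    refine tsum_congr fun n => ?_
    rw [mul_comm]
    simp only [Equiv.neg_apply, Int.cast_neg, sub_neg_eq_add, negFourierChar]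
    congr 2
    push_cast; ring
  · intro n hn
    rw [hf, φ.zero_of_le_dist, Complex.ofReal_zero, zero_mul]
    have h1 : (1 : ℝ) ≤ |(n : ℝ)| := by exact_mod_cast Int.one_le_abs hn
    have h2 : |(n : ℝ)| ≤ |x + n| + |x| := by
      have := abs_sub (x + n) x
      simpa using this
    rw [Real.dist_eq, sub_zero]
    linarith

/-! ### Polynomial decay and uniform summability on the line -/

theorem SchwartzMap.exists_enorm_le_enormWeight_rpow (f : 𝓢(ℝ, ℂ)) (N : ℕ) :
    ∃ C : ℝ≥0, ∀ u : ℝ, ‖f u‖ₑ ≤ C * enormWeight u ^ (-(N : ℝ)) := by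
  refine ⟨Real.toNNReal (2 ^ N * (Finset.Iic (N, 0)).sup
    (fun m => SchwartzMap.seminorm ℝ m.1 m.2) f), fun u => ?_⟩
  have h := SchwartzMap.one_add_le_sup_seminorm_apply (𝕜 := ℝ) (m := (N, 0)) le_rfl le_rfl f u
  rw [norm_iteratedFDeriv_zero] at h
  have h2 := ENNReal.ofReal_le_ofReal h
  rw [ENNReal.ofReal_mul (by positivity), ENNReal.ofReal_pow (by positivity),
    ENNReal.ofReal_add zero_le_one (norm_nonneg _), ofReal_norm, ofReal_norm,
    ENNReal.ofReal_one] at h2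
  rw [ENNReal.rpow_neg, ENNReal.rpow_natCast, ← div_eq_mul_inv, ENNReal.le_div_iff_mul_le
    (Or.inl (pow_ne_zero _ (enormWeight_ne_zero u)))
    (Or.inl (ENNReal.pow_ne_top (enormWeight_ne_top u))), mul_comm]
  exact h2

lemma enormWeight_rpow_eq_ofReal {E : Type*} [NormedAddCommGroup E] (u : E) (e : ℝ) :
    enormWeight u ^ e = ENNReal.ofReal ((1 + ‖u‖) ^ e) := by
  rw [← ENNReal.ofReal_rpow_of_pos (by positivity), ENNReal.ofReal_add zero_le_one (norm_nonneg _),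
    ENNReal.ofReal_one, ofReal_norm, enormWeight]

theorem lintegral_enormWeight_sub_rpow_lt_top {r : ℝ} (hr : 1 < r) (t : ℝ) :
    ∫⁻ w : ℝ, enormWeight (t - w) ^ (-r) = ∫⁻ w : ℝ, enormWeight w ^ (-r) ∧
    ∫⁻ w : ℝ, enormWeight w ^ (-r) < ∞ := by
  refine ⟨lintegral_sub_left_eq_self (fun w => enormWeight w ^ (-r)) t, ?_⟩
  simp_rw [enormWeight_rpow_eq_ofReal]
  exact finite_integral_one_add_norm (E := ℝ) (by simpa using hr)

theorem tsum_enormWeight_int_rpow_lt_top {r : ℝ} (hr : 1 < r) :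
    ∑' n : ℤ, enormWeight (n : ℝ) ^ (-r) < ∞ := by
  have h1 : Summable fun n : ℤ => |(n : ℝ)| ^ (-r) := Real.summable_abs_int_rpow hr
  have h2 : Summable fun n : ℤ => (1 + ‖(n : ℝ)‖) ^ (-r) := by
    refine Summable.of_norm_bounded_eventually h1 ?_
    filter_upwards [Set.Finite.compl_mem_cofinite (Set.finite_singleton (0 : ℤ))] with n hn
    have hn : 0 < |(n : ℝ)| := by
      have : n ≠ 0 := by simpa using hn
      positivity
    rw [Real.norm_of_nonneg (by positivity)]
    exact Real.rpow_le_rpow_of_nonpos hn (by simp) (by linarith)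
  simp_rw [enormWeight_rpow_eq_ofReal]
  rw [← ENNReal.ofReal_tsum_of_nonneg (fun n => by positivity) h2]
  exact ENNReal.ofReal_lt_top

lemma rpow_neg_le_mul_rpow_neg {a b c : ℝ≥0∞} {r : ℝ} (hr : 0 ≤ r) (hc : c ≠ 0) (hc' : c ≠ ∞)
    (h : a ≤ c * b) : b ^ (-r) ≤ c ^ r * a ^ (-r) := by
  have h3 := ENNReal.rpow_le_rpow h hr
  rw [ENNReal.mul_rpow_of_nonneg _ _ hr] at h3
  have hcr : c ^ r ≠ 0 := by simp [ENNReal.rpow_eq_zero_iff, hc, hc']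
  have hcr' : c ^ r ≠ ∞ := ENNReal.rpow_ne_top_of_nonneg hr hc'
  rw [ENNReal.rpow_neg, ENNReal.rpow_neg, ENNReal.inv_le_iff_inv_le,
    ENNReal.mul_inv (Or.inl hcr) (Or.inl hcr'), inv_inv, mul_comm, ← div_eq_mul_inv]
  exact ENNReal.div_le_of_le_mul (by rwa [mul_comm])

/-- Shifting `n` by `⌊t/α⌋` reduces every `t` to one convergent series: `|n - ⌊t/α⌋| ≤ 1 + |t -
αn|/α`, which yields the factor `2 + 1/α`. -/
theorem exists_tsum_enormWeight_sub_mul_int_rpow_le {r α : ℝ} (hr : 1 < r) (hα : 0 < α) :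
    ∃ B : ℝ≥0, ∀ t : ℝ, ∑' n : ℤ, enormWeight (t - α * n) ^ (-r) ≤ B := by
  have hfin := tsum_enormWeight_int_rpow_lt_top hr
  have hc : (0 : ℝ) ≤ 2 + 1 / α := by positivity
  have hB : ENNReal.ofReal (2 + 1 / α) ^ r * ∑' n : ℤ, enormWeight (n : ℝ) ^ (-r) ≠ ∞ :=
    ENNReal.mul_ne_top (ENNReal.rpow_ne_top_of_nonneg (by linarith) ENNReal.ofReal_ne_top) hfin.ne
  refine ⟨(ENNReal.ofReal (2 + 1 / α) ^ r * ∑' n : ℤ, enormWeight (n : ℝ) ^ (-r)).toNNReal,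
    fun t => ?_⟩
  rw [ENNReal.coe_toNNReal hB, ← (Equiv.subRight ⌊t / α⌋).tsum_eq
    (fun n : ℤ => enormWeight (n : ℝ) ^ (-r)), ← ENNReal.tsum_mul_left]
  refine ENNReal.tsum_le_tsum fun n => ?_
  have key : 1 + ‖((n - ⌊t / α⌋ : ℤ) : ℝ)‖ ≤ (2 + 1 / α) * (1 + ‖t - α * n‖) := by
    have h1 : |((n - ⌊t / α⌋ : ℤ) : ℝ)| ≤ 1 + |t - α * n| / α := by
      have e : |t - α * n| / α = |t / α - n| := by
        rw [← abs_of_pos hα, ← abs_div, abs_of_pos hα]; congr 1; field_simp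
      rw [e]
      have h2 := Int.floor_le (t / α)
      have h3 := Int.lt_floor_add_one (t / α)
      push_cast
      rcases abs_cases (t / α - n) with ⟨h, h0⟩ | ⟨h, h0⟩ <;> rw [h, abs_le] <;>
        constructor <;> linarith
    simp only [Real.norm_eq_abs]
    have h4 : 0 ≤ |t - α * n| := abs_nonneg _
    have h5 : 0 ≤ 1 / α := by positivity
    have h6 : |t - α * n| / α = 1 / α * |t - α * n| := by ring
    nlinarith
  have key2 : enormWeight ((n - ⌊t / α⌋ : ℤ) : ℝ) ≤
      ENNReal.ofReal (2 + 1 / α) * enormWeight (t - α * n) := by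
    have := ENNReal.ofReal_le_ofReal key
    rwa [ENNReal.ofReal_mul hc, ENNReal.ofReal_add zero_le_one (norm_nonneg _),
      ENNReal.ofReal_add zero_le_one (norm_nonneg _), ofReal_norm, ofReal_norm,
      ENNReal.ofReal_one] at this
  have h0 : 0 < 2 + 1 / α := by positivity
  exact rpow_neg_le_mul_rpow_neg (by linarith) (by simpa using h0) ENNReal.ofReal_ne_top key2

/-! ### Fourier transforms of measures carried by a cube -/

lemma measureFourier_eq_integral_negFourierChar {d : ℕ} (μ : Measure (EuclideanSpace ℝ (Fin d)))
    (z : EuclideanSpace ℝ (Fin d)) :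
    measureFourier μ z = ∫ x, negFourierChar (inner ℝ x z) ∂μ := rfl

lemma negFourierChar_mul_measureFourier {d : ℕ} (μ : Measure (EuclideanSpace ℝ (Fin d)))
    (a z : EuclideanSpace ℝ (Fin d)) :
    negFourierChar (-inner ℝ a z) * measureFourier μ z =
      ∫ x, negFourierChar (inner ℝ (x - a) z) ∂μ := by
  rw [measureFourier_eq_integral_negFourierChar, ← integral_const_mul]
  congr 1 with x
  rw [← negFourierChar_add, inner_sub_left]
  congr 1; ring

lemma enorm_measureFourier_eq {d : ℕ} (μ : Measure (EuclideanSpace ℝ (Fin d)))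
    (a z : EuclideanSpace ℝ (Fin d)) :
    ‖measureFourier μ z‖ₑ = ‖∫ x, negFourierChar (inner ℝ (x - a) z) ∂μ‖ₑ := by
  rw [← negFourierChar_mul_measureFourier, enorm_mul, enorm_negFourierChar, one_mul]

lemma negFourierChar_inner {d : ℕ} (x z : EuclideanSpace ℝ (Fin d)) :
    negFourierChar (inner ℝ x z) = ∏ i, negFourierChar (x i * z i) := by
  rw [← negFourierChar_sum, PiLp.inner_apply]
  congr 1
  exact Finset.sum_congr rfl fun i _ => by simp [mul_comm]

@[fun_prop]
lemma continuous_measureFourier {d : ℕ} (μ : Measure (EuclideanSpace ℝ (Fin d)))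
    [IsFiniteMeasure μ] : Continuous (measureFourier μ) := by
  refine continuous_of_dominated (F := fun z x => negFourierChar (inner ℝ x z))
    (bound := fun _ => 1) (fun z => ?_) (fun z => ?_) (integrable_const _) ?_
  · exact (continuous_negFourierChar.comp (by fun_prop)).aestronglyMeasurable
  · exact Filter.Eventually.of_forall fun x => (norm_negFourierChar _).le
  · exact Filter.Eventually.of_forall fun x => continuous_negFourierChar.comp (by fun_prop)

lemma enorm_measureFourier_le {d : ℕ} (μ : Measure (EuclideanSpace ℝ (Fin d)))
    (z : EuclideanSpace ℝ (Fin d)) : ‖measureFourier μ z‖ₑ ≤ μ Set.univ := by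
  rw [measureFourier_eq_integral_negFourierChar]
  refine (enorm_integral_le_lintegral_enorm _).trans ?_
  simp [enorm_negFourierChar]

lemma enorm_measureFourier_zero {d : ℕ} (μ : Measure (EuclideanSpace ℝ (Fin d)))
    [IsFiniteMeasure μ] : ‖measureFourier μ 0‖ₑ = μ Set.univ := by
  have : measureFourier μ 0 = ((μ.real Set.univ : ℝ) : ℂ) := by simp [measureFourier]
  rw [this, ← ofReal_norm, Complex.norm_real, Real.norm_of_nonneg measureReal_nonneg,
    ofReal_measureReal]

/-- A one-dimensional sampling formula with kernel `κ`, applied in each coordinate, bounds the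
Fourier transform of a measure carried by a cube by averages of its values at the samples. -/
theorem enorm_measureFourier_le_lintegral {Ω : Type*} [MeasurableSpace Ω] {ν : Measure Ω}
    [SigmaFinite ν] {p : Ω → ℝ} (hp : Measurable p) {κ : ℝ → ℂ} {ρ : ℝ}
    (hrep : ∀ x t : ℝ, |x| ≤ ρ →
      ∫ ω, negFourierChar (x * p ω) * κ (t - p ω) ∂ν = negFourierChar (x * t))
    (hint : ∀ t, Integrable (fun ω => κ (t - p ω)) ν) {d : ℕ}
    (μ : Measure (EuclideanSpace ℝ (Fin d))) [IsFiniteMeasure μ]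
    {a : EuclideanSpace ℝ (Fin d)} (ha : ∀ᵐ x ∂μ, ∀ i, |x i - a i| ≤ ρ)
    (z : EuclideanSpace ℝ (Fin d)) :
    ‖measureFourier μ z‖ₑ ≤ ∫⁻ ω, ‖measureFourier μ (WithLp.toLp 2 fun i => p (ω i))‖ₑ *
      ∏ i, ‖κ (z i - p (ω i))‖ₑ ∂(Measure.pi fun _ : Fin d => ν) := by
  set P : (Fin d → Ω) → EuclideanSpace ℝ (Fin d) := fun ω => WithLp.toLp 2 fun i => p (ω i) with hPd
  have hP : Measurable P := by fun_prop
  have hpt : ∀ᵐ x ∂μ, negFourierChar (inner ℝ (x - a) z) =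
      ∫ ω, negFourierChar (inner ℝ (x - a) (P ω)) * ∏ i, κ (z i - p (ω i))
        ∂(Measure.pi fun _ : Fin d => ν) := by
    filter_upwards [ha] with x hx
    rw [negFourierChar_inner]
    calc _ = ∏ i, ∫ ω, negFourierChar ((x - a) i * p ω) * κ (z i - p ω) ∂ν :=
          Finset.prod_congr rfl fun i _ => (hrep _ _ (hx i)).symm
      _ = _ := by
          rw [← integral_fintype_prod_eq_prod]
          simp_rw [Finset.prod_mul_distrib, negFourierChar_inner]
          rfl
  have hintprod : Integrable (fun ω : Fin d → Ω => ∏ i, κ (z i - p (ω i)))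
      (Measure.pi fun _ : Fin d => ν) :=
    Integrable.fintype_prod (f := fun i ω => κ (z i - p ω)) fun i => hint (z i)
  have hintprod2 : Integrable (Function.uncurry fun (x : EuclideanSpace ℝ (Fin d))
      (ω : Fin d → Ω) => negFourierChar (inner ℝ (x - a) (P ω)) * ∏ i, κ (z i - p (ω i)))
      (μ.prod (Measure.pi fun _ : Fin d => ν)) := by
    refine (hintprod.comp_snd μ).bdd_mul (c := 1) ?_ ?_
    · exact (continuous_negFourierChar.measurable.comp
        (by fun_prop)).aestronglyMeasurable
    · exact Filter.Eventually.of_forall fun x => (norm_negFourierChar _).le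
  rw [enorm_measureFourier_eq μ a z, integral_congr_ae hpt, integral_integral_swap hintprod2]
  refine (enorm_integral_le_lintegral_enorm _).trans (lintegral_mono fun ω => ?_)
  rw [integral_mul_const, enorm_mul, ← enorm_measureFourier_eq]
  gcongr
  simp only [enorm_eq_nnnorm, nnnorm_prod, ENNReal.ofNNReal_finsetProd, le_refl]

/-- Each coordinate is 1-Lipschitz, so the midpoint of its range serves as centre. A ball of radius
half the diameter need not suffice, whereas a cube does; this is why the condition `αR < 1` is
enough. -/
theorem exists_abs_sub_le_half_diam {d : ℕ} {S : Set (EuclideanSpace ℝ (Fin d))}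
    (hS : Bornology.IsBounded S) :
    ∃ a : EuclideanSpace ℝ (Fin d), ∀ x ∈ S, ∀ i, |x i - a i| ≤ Metric.diam S / 2 := by
  refine ⟨WithLp.toLp 2 fun i =>
    (sInf ((fun x : EuclideanSpace ℝ (Fin d) => x i) '' S) +
      sSup ((fun x : EuclideanSpace ℝ (Fin d) => x i) '' S)) / 2, fun x hx i => ?_⟩
  set T := (fun x : EuclideanSpace ℝ (Fin d) => x i) '' S with hT
  have hL : LipschitzWith 1 (fun x : EuclideanSpace ℝ (Fin d) => x i) := by
    refine LipschitzWith.of_dist_le_mul fun x y => ?_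
    rw [NNReal.coe_one, one_mul, dist_eq_norm, dist_eq_norm]
    exact PiLp.norm_apply_le (x - y) i
  have hTb : Bornology.IsBounded T := hL.isBounded_image hS
  have h1 : Metric.diam T ≤ Metric.diam S := by
    simpa using hL.diam_image_le S hS
  rw [Real.diam_eq hTb] at h1
  have h2 : sInf T ≤ x i := csInf_le hTb.bddBelow ⟨x, hx, rfl⟩
  have h3 : x i ≤ sSup T := le_csSup hTb.bddAbove ⟨x, hx, rfl⟩
  change |x i - (sInf T + sSup T) / 2| ≤ _
  rw [abs_le]
  constructor <;> linarith

theorem ContDiffBump.integral_rescaled_fourier (φ : ContDiffBump (0 : ℝ)) {α : ℝ} (hα : 0 < α)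
    {x : ℝ} (hx : |x * α| ≤ φ.rIn) (t : ℝ) :
    ∫ w : ℝ, negFourierChar (x * w) * ((α : ℂ)⁻¹ * 𝓕 φ.toComplexSchwartz ((t - w) / α)) =
      negFourierChar (x * t) := by
  have h := integral_negFourierChar_mul_fourier_bump φ hx (t / α)
  have h2 := Measure.integral_comp_div (fun v : ℝ => negFourierChar (x * α * v) *
    𝓕 φ.toComplexSchwartz (t / α - v)) α
  rw [h, abs_of_pos hα] at h2
  have e : ∀ w : ℝ, negFourierChar (x * w) *
      ((α : ℂ)⁻¹ * 𝓕 φ.toComplexSchwartz ((t - w) / α)) = (α : ℂ)⁻¹ *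
        (negFourierChar (x * α * (w / α)) * 𝓕 φ.toComplexSchwartz (t / α - w / α)) := by
    intro w
    rw [mul_assoc x, mul_div_cancel₀ _ hα.ne', sub_div]
    ring
  simp_rw [e]
  rw [integral_const_mul, h2, mul_assoc x, mul_div_cancel₀ _ hα.ne', Complex.real_smul,
    inv_mul_cancel_left₀ (by exact_mod_cast hα.ne')]

theorem ContDiffBump.tsum_rescaled_fourier (φ : ContDiffBump (0 : ℝ)) {α : ℝ} (hα : 0 < α)
    (hφ : φ.rIn + φ.rOut ≤ 1) {x : ℝ} (hx : |x * α| ≤ φ.rIn) (t : ℝ) :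
    ∑' n : ℤ, negFourierChar (x * (α * n)) * 𝓕 φ.toComplexSchwartz ((t - α * n) / α) =
      negFourierChar (x * t) := by
  have h := tsum_negFourierChar_mul_fourier_bump φ hx hφ (t / α)
  rw [mul_assoc x, mul_div_cancel₀ _ hα.ne'] at h
  rw [← h]
  refine tsum_congr fun n => ?_
  rw [sub_div, mul_div_cancel_left₀ _ hα.ne', mul_assoc]

lemma enormWeight_le_mul_enormWeight_div {α : ℝ} (hα : 0 < α) (u : ℝ) :
    enormWeight u ≤ ENNReal.ofReal (1 + α) * enormWeight (u / α) := by
  have h : 1 + ‖u‖ ≤ (1 + α) * (1 + ‖u / α‖) := by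
    have : ‖u‖ = α * ‖u / α‖ := by
      rw [norm_div, Real.norm_of_nonneg hα.le, mul_div_cancel₀ _ hα.ne']
    have h2 : 0 ≤ ‖u / α‖ := norm_nonneg _
    nlinarith
  have h2 := ENNReal.ofReal_le_ofReal h
  rwa [ENNReal.ofReal_mul (by positivity), ENNReal.ofReal_add zero_le_one (norm_nonneg _),
    ENNReal.ofReal_add zero_le_one (norm_nonneg _), ofReal_norm, ofReal_norm,
    ENNReal.ofReal_one] at h2

/-! ### Product kernels and pointwise domination -/

/-- The point of the lattice `α ℤ^d` with integer coordinates `k`. -/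
noncomputable def scaledLatticePoint {d : ℕ} (α : ℝ) (k : Fin d → ℤ) : EuclideanSpace ℝ (Fin d) :=
  WithLp.toLp 2 fun i => α * (k i : ℝ)

/-- A product kernel of polynomial decay on `ℝ^d`. -/
noncomputable def productKernel {d : ℕ} (C : ℝ≥0) (N : ℕ) (u : EuclideanSpace ℝ (Fin d)) : ℝ≥0∞ :=
  ∏ i, (C * enormWeight (u i) ^ (-(N : ℝ)))

@[fun_prop]
lemma measurable_productKernel {d : ℕ} (C : ℝ≥0) (N : ℕ) :
    Measurable (productKernel C N : EuclideanSpace ℝ (Fin d) → ℝ≥0∞) := by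
  unfold productKernel; fun_prop

lemma productKernel_sub_comm {d : ℕ} (C : ℝ≥0) (N : ℕ) (z w : EuclideanSpace ℝ (Fin d)) :
    productKernel C N (z - w) = productKernel C N (w - z) := by
  unfold productKernel
  refine Finset.prod_congr rfl fun i _ => ?_
  rw [PiLp.sub_apply, enormWeight_sub_comm, PiLp.sub_apply]

/-- The weight is at most the product of its coordinate weights, so a moment of order `m` costs `m`
in each coordinate and still leaves summable decay of order 2. -/
lemma productKernel_mul_enormWeight_rpow_le {d : ℕ} (C : ℝ≥0) {N : ℕ} {m : ℝ} (hm : 0 ≤ m)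
    (hN : m + 2 ≤ N) (u : EuclideanSpace ℝ (Fin d)) :
    productKernel C N u * enormWeight u ^ m ≤ ∏ i, (C * enormWeight (u i) ^ (-(2 : ℝ))) := by
  calc _ ≤ productKernel C N u * ∏ i, enormWeight (u i) ^ m := by
        rw [ENNReal.prod_rpow_of_nonneg hm]
        gcongr
        exact enormWeight_le_prod u
    _ = ∏ i, (C * enormWeight (u i) ^ (-(N : ℝ) + m)) := by
        rw [productKernel, ← Finset.prod_mul_distrib]
        refine Finset.prod_congr rfl fun i _ => ?_
        rw [ENNReal.rpow_add _ _ (enormWeight_ne_zero _) (enormWeight_ne_top _), mul_assoc]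
    _ ≤ _ := by
        gcongr with i
        · exact one_le_enormWeight _
        · linarith

theorem lintegral_pi_productKernel_le {Ω : Type*} [MeasurableSpace Ω] {ν : Measure Ω}
    [SigmaFinite ν] {p : Ω → ℝ} (hp : Measurable p) {B : ℝ≥0}
    (hB : ∀ t, ∫⁻ ω, enormWeight (t - p ω) ^ (-(2 : ℝ)) ∂ν ≤ B) {d : ℕ} (C : ℝ≥0) {N : ℕ}
    {m : ℝ} (hm : 0 ≤ m) (hN : m + 2 ≤ N) (z : EuclideanSpace ℝ (Fin d)) :
    ∫⁻ ω, productKernel C N (z - WithLp.toLp 2 fun i => p (ω i)) *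
      enormWeight (z - WithLp.toLp 2 fun i => p (ω i)) ^ m ∂(Measure.pi fun _ : Fin d => ν) ≤
        ((C * B) ^ d : ℝ≥0) := by
  calc _ ≤ ∫⁻ ω, ∏ i, (C * enormWeight (z i - p (ω i)) ^ (-(2 : ℝ)))
        ∂(Measure.pi fun _ : Fin d => ν) := by
        refine lintegral_mono fun ω => (productKernel_mul_enormWeight_rpow_le C hm hN
          (z - WithLp.toLp 2 fun i => p (ω i))).trans_eq ?_
        simp only [PiLp.sub_apply]
    _ = ∏ i, ∫⁻ ω, C * enormWeight (z i - p ω) ^ (-(2 : ℝ)) ∂ν := by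
        rw [← lintegral_pi_prod_eq_prod_lintegral ν
          (fun i ω => C * enormWeight (z i - p ω) ^ (-(2 : ℝ))) (fun i => by fun_prop)]
    _ ≤ ∏ _i : Fin d, ((C * B : ℝ≥0) : ℝ≥0∞) := by
        gcongr with i
        rw [lintegral_const_mul _ (by fun_prop), ENNReal.coe_mul]
        gcongr
        exact hB _
    _ = _ := by simp

theorem integrable_of_enorm_le_enormWeight {Ω : Type*} [MeasurableSpace Ω] {ν : Measure Ω}
    {p : Ω → ℝ} (hp : Measurable p) {B : ℝ≥0}
    (hB : ∀ t, ∫⁻ ω, enormWeight (t - p ω) ^ (-(2 : ℝ)) ∂ν ≤ B) {κ : ℝ → ℂ} (hκ : Continuous κ)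
    {C : ℝ≥0} {N : ℕ} (hN : 2 ≤ N) (h : ∀ u, ‖κ u‖ₑ ≤ C * enormWeight u ^ (-(N : ℝ))) (t : ℝ) :
    Integrable (fun ω => κ (t - p ω)) ν := by
  refine ⟨(hκ.measurable.comp (by fun_prop)).aestronglyMeasurable, ?_⟩
  calc ∫⁻ ω, ‖κ (t - p ω)‖ₑ ∂ν ≤ ∫⁻ ω, C * enormWeight (t - p ω) ^ (-(2 : ℝ)) ∂ν := by
        refine lintegral_mono fun ω => (h _).trans ?_
        gcongr
        · exact one_le_enormWeight _
        · exact_mod_cast hN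
    _ = C * ∫⁻ ω, enormWeight (t - p ω) ^ (-(2 : ℝ)) ∂ν := lintegral_const_mul _ (by fun_prop)
    _ ≤ C * B := by gcongr; exact hB t
    _ < ∞ := by exact_mod_cast ENNReal.coe_lt_top

/-- Meant for two sampling schemes: Lebesgue measure with `p = id`, and counting measure on `ℤ` with
`p n = αn`. -/
theorem enorm_measureFourier_le_lintegral_productKernel {Ω : Type*} [MeasurableSpace Ω]
    {ν : Measure Ω} [SigmaFinite ν] {p : Ω → ℝ} (hp : Measurable p) {B : ℝ≥0}
    (hB : ∀ t, ∫⁻ ω, enormWeight (t - p ω) ^ (-(2 : ℝ)) ∂ν ≤ B) {κ : ℝ → ℂ} (hκ : Continuous κ)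
    {C : ℝ≥0} {N : ℕ} (hN : 2 ≤ N) (hC : ∀ u, ‖κ u‖ₑ ≤ C * enormWeight u ^ (-(N : ℝ))) {R : ℝ}
    (hrep : ∀ x t : ℝ, |x| ≤ R / 2 →
      ∫ ω, negFourierChar (x * p ω) * κ (t - p ω) ∂ν = negFourierChar (x * t))
    {d : ℕ} (μ : Measure (EuclideanSpace ℝ (Fin d))) [IsFiniteMeasure μ]
    (hμ : IsCompact μ.support) (hdiam : Metric.diam μ.support = R)
    (z : EuclideanSpace ℝ (Fin d)) :
    ‖measureFourier μ z‖ₑ ≤ ∫⁻ ω, ‖measureFourier μ (WithLp.toLp 2 fun i => p (ω i))‖ₑ *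
      productKernel C N (z - WithLp.toLp 2 fun i => p (ω i)) ∂(Measure.pi fun _ : Fin d => ν) := by
  obtain ⟨a, ha⟩ := exists_abs_sub_le_half_diam hμ.isBounded
  rw [hdiam] at ha
  refine (enorm_measureFourier_le_lintegral hp hrep
    (integrable_of_enorm_le_enormWeight hp hB hκ hN hC) μ (a := a) ?_ z).trans ?_
  · filter_upwards [Measure.support_mem_ae (μ := μ)] with x hx using ha x hx
  · refine lintegral_mono fun ω => ?_
    unfold productKernel
    gcongr with i
    exact hC _

/-- Domination of `|μ̂|` by its averages over `ℝ^d` and over `α ℤ^d`, with a common kernel of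
arbitrarily fast decay. -/
theorem exists_productKernel_domination (d : ℕ) {R α : ℝ} (hR : 0 < R) (hα : 0 < α)
    (hαR : α < 1 / R) {m : ℝ} (hm : 0 ≤ m) :
    ∃ (C : ℝ≥0) (N : ℕ) (M : ℝ≥0),
      (∀ z : EuclideanSpace ℝ (Fin d),
        ∫⁻ w, productKernel C N (z - w) * enormWeight (z - w) ^ m ≤ M) ∧
      (∀ z : EuclideanSpace ℝ (Fin d),
        ∫⁻ k, productKernel C N (z - scaledLatticePoint α k) *
          enormWeight (z - scaledLatticePoint α k) ^ m ∂Measure.count ≤ M) ∧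
      ∀ (μ : Measure (EuclideanSpace ℝ (Fin d))) [IsFiniteMeasure μ],
        IsCompact μ.support → Metric.diam μ.support = R → ∀ z,
          ‖measureFourier μ z‖ₑ ≤ ∫⁻ w, ‖measureFourier μ w‖ₑ * productKernel C N (z - w) ∧
          ‖measureFourier μ z‖ₑ ≤ ∫⁻ k, ‖measureFourier μ (scaledLatticePoint α k)‖ₑ *
            productKernel C N (z - scaledLatticePoint α k) ∂Measure.count := by
  have hαR1 : α * R < 1 := by rwa [lt_div_iff₀ hR] at hαR
  -- The inner radius covers the rescaled half-side, and the outer one keeps `rIn + rOut ≤ 1` for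
  -- Poisson summation. That inner is less than outer is exactly `αR < 1`.
  let φ : ContDiffBump (0 : ℝ) := ⟨α * R / 2, 1 / 2, by positivity, by linarith⟩
  have hin : φ.rIn = α * R / 2 := rfl
  have hsum : φ.rIn + φ.rOut ≤ 1 := by
    change α * R / 2 + 1 / 2 ≤ 1
    linarith
  have hx (x : ℝ) (hx : |x| ≤ R / 2) : |x * α| ≤ φ.rIn := by
    rw [abs_mul, abs_of_pos hα, hin]
    nlinarith
  set N : ℕ := ⌈m⌉₊ + 2 with hN
  have hNm : m + 2 ≤ N := by
    rw [hN]; push_cast; linarith [Nat.le_ceil m]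
  have hN2 : 2 ≤ N := by omega
  obtain ⟨C₀, hC₀⟩ := (𝓕 φ.toComplexSchwartz).exists_enorm_le_enormWeight_rpow N
  have hcont : Continuous fun u : ℝ => 𝓕 φ.toComplexSchwartz (u / α) :=
    (𝓕 φ.toComplexSchwartz).continuous.comp (by fun_prop)
  set C₁ : ℝ≥0 := C₀ * Real.toNNReal (1 + α) ^ (N : ℝ) with hC₁d
  have hC₁ (u : ℝ) : ‖𝓕 φ.toComplexSchwartz (u / α)‖ₑ ≤ C₁ * enormWeight u ^ (-(N : ℝ)) := by
    refine (hC₀ _).trans ?_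
    have h1 : 0 < 1 + α := by positivity
    rw [hC₁d, ENNReal.coe_mul, mul_assoc, ENNReal.coe_rpow_of_nonneg _ (Nat.cast_nonneg N)]
    gcongr
    exact rpow_neg_le_mul_rpow_neg (Nat.cast_nonneg N) (by simpa using h1) ENNReal.coe_ne_top
      (enormWeight_le_mul_enormWeight_div hα u)
  -- One constant for both kernels: the integral formula carries the Jacobian `α⁻¹`, the sum does
  -- not.
  set C : ℝ≥0 := max 1 (Real.toNNReal α⁻¹) * C₁ with hCd
  have hC1 (u : ℝ) : ‖𝓕 φ.toComplexSchwartz (u / α)‖ₑ ≤ C * enormWeight u ^ (-(N : ℝ)) := by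
    refine (hC₁ u).trans ?_
    gcongr
    exact le_mul_of_one_le_left zero_le (le_max_left _ _)
  have hC2 (u : ℝ) : ‖(α : ℂ)⁻¹ * 𝓕 φ.toComplexSchwartz (u / α)‖ₑ ≤
      C * enormWeight u ^ (-(N : ℝ)) := by
    rw [enorm_mul, hCd, ENNReal.coe_mul, mul_assoc]
    gcongr
    · have : ‖(α : ℂ)⁻¹‖ₑ = ((Real.toNNReal α⁻¹ : ℝ≥0) : ℝ≥0∞) := by
        rw [← ofReal_norm, norm_inv, Complex.norm_real, Real.norm_of_nonneg hα.le]; rfl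
      rw [this]
      exact_mod_cast le_max_right _ _
    · exact hC₁ u
  obtain ⟨B₁, hB₁⟩ := exists_tsum_enormWeight_sub_mul_int_rpow_le one_lt_two hα
  have hB₂ := (lintegral_enormWeight_sub_rpow_lt_top one_lt_two 0).2.ne
  set B₂ := (∫⁻ w : ℝ, enormWeight w ^ (-(2 : ℝ))).toNNReal with hB₂d
  have hBd (t : ℝ) : ∫⁻ n : ℤ, enormWeight (t - α * n) ^ (-(2 : ℝ)) ∂Measure.count ≤
      (max B₁ B₂ : ℝ≥0) := by
    rw [lintegral_count]
    exact (hB₁ t).trans (by exact_mod_cast le_max_left _ _)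
  have hBc (t : ℝ) : ∫⁻ w : ℝ, enormWeight (t - w) ^ (-(2 : ℝ)) ≤ (max B₁ B₂ : ℝ≥0) := by
    rw [(lintegral_enormWeight_sub_rpow_lt_top one_lt_two t).1, ← ENNReal.coe_toNNReal hB₂]
    exact ENNReal.coe_le_coe.mpr (le_max_right _ _)
  have hvol (F : EuclideanSpace ℝ (Fin d) → ℝ≥0∞) :
      ∫⁻ w, F w = ∫⁻ w : Fin d → ℝ, F (WithLp.toLp 2 fun i => w i)
        ∂(Measure.pi fun _ => volume) := by
    rw [← volume_pi]
    exact ((PiLp.volume_preserving_toLp (Fin d)).lintegral_comp_emb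
      (MeasurableEquiv.toLp 2 (Fin d → ℝ)).measurableEmbedding F).symm
  have hαint : Measurable fun n : ℤ => α * (n : ℝ) := by fun_prop
  refine ⟨C, N, (C * max B₁ B₂) ^ d, fun z => ?_, fun z => ?_, fun μ _ hμ hdiam z => ⟨?_, ?_⟩⟩
  · rw [hvol]
    exact lintegral_pi_productKernel_le measurable_id hBc C hm hNm z
  · rw [← pi_count_eq_count]
    exact lintegral_pi_productKernel_le hαint hBd C hm hNm z
  · rw [hvol]
    exact enorm_measureFourier_le_lintegral_productKernel measurable_id hBc
      (κ := fun u => (α : ℂ)⁻¹ * 𝓕 φ.toComplexSchwartz (u / α)) (by fun_prop) hN2 hC2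
      (fun x t h => φ.integral_rescaled_fourier hα (hx x h) t) μ hμ hdiam z
  · rw [← pi_count_eq_count]
    refine enorm_measureFourier_le_lintegral_productKernel hαint hBd hcont hN2 hC1
      (fun x t h => ?_) μ hμ hdiam z
    rw [integral_countable]
    · simpa using φ.tsum_rescaled_fourier hα hsum (hx x h) t
    · refine (integrable_of_enorm_le_enormWeight hαint hBd hcont hN2 hC1 t).bdd_mul (c := 1) ?_ ?_
      · exact (measurable_of_countable _).aestronglyMeasurable
      · exact Filter.Eventually.of_forall fun n => (norm_negFourierChar _).le

/-! ### Comparison of space and lattice with inhomogeneous weights -/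

/-- Two-sided comparison, uniform in `p`, of the weighted `L^p` norms of `μ̂` over `ℝ^d` and over
the lattice `α ℤ^d`. -/
theorem exists_weighted_lintegral_comparison (d : ℕ) {R α s : ℝ} (hR : 0 < R) (hα : 0 < α)
    (hαR : α < 1 / R) (hs : 0 < s) :
    ∃ M : ℝ≥0, ∀ (μ : Measure (EuclideanSpace ℝ (Fin d))) [IsFiniteMeasure μ],
      IsCompact μ.support → Metric.diam μ.support = R → ∀ q : ℝ, 1 ≤ q →
        ∫⁻ z, ‖measureFourier μ z‖ₑ ^ (2 * q) * enormWeight z ^ (s * q - d) ≤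
          (M : ℝ≥0∞) ^ q * ∑' k, ‖measureFourier μ (scaledLatticePoint α k)‖ₑ ^ (2 * q) *
            enormWeight (scaledLatticePoint α k) ^ (s * q - d) ∧
        ∑' k, ‖measureFourier μ (scaledLatticePoint α k)‖ₑ ^ (2 * q) *
            enormWeight (scaledLatticePoint α k) ^ (s * q - d) ≤
          (M : ℝ≥0∞) ^ q *
            ∫⁻ z, ‖measureFourier μ z‖ₑ ^ (2 * q) * enormWeight z ^ (s * q - d) := by
  have hm : 0 ≤ s / 2 + (d : ℝ) := by positivity
  obtain ⟨C, N, M, hc, hd, hdom⟩ := exists_productKernel_domination d hR hα hαR hm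
  have hle (u : EuclideanSpace ℝ (Fin d)) : productKernel C N u * enormWeight u ^ (s / 2) ≤
      productKernel C N u * enormWeight u ^ (s / 2 + (d : ℝ)) := by
    gcongr
    · exact one_le_enormWeight u
    · simp
  have hP : Measurable (scaledLatticePoint α : (Fin d → ℤ) → EuclideanSpace ℝ (Fin d)) :=
    measurable_of_countable _
  -- The Schur test at `p = 2q` gives `M ^ (2q) = (M ^ 2) ^ q`.
  refine ⟨M ^ 2, fun μ _ hμ hdiam q hq => ?_⟩
  have hf : Measurable fun z => ‖measureFourier μ z‖ₑ :=
    (continuous_measureFourier μ).measurable.enorm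
  -- Here `a = s/2` and `b = d`, so the moments needed do not depend on `q`.
  have e : s * q - d = s / 2 * (2 * q) - d := by ring
  have hMq : ((M ^ 2 : ℝ≥0) : ℝ≥0∞) ^ q = (M : ℝ≥0∞) ^ (2 * q) := by
    rw [ENNReal.rpow_mul, ENNReal.coe_pow]; norm_cast
  rw [hMq, e, ← lintegral_count]
  constructor
  · refine lintegral_weighted_le_of_le_lintegral volume Measure.count measurable_id hP hf
      (measurable_productKernel C N) (by positivity) (Nat.cast_nonneg d) (by linarith)
      (fun z => (hdom μ hμ hdiam z).2) (fun z => (lintegral_mono fun k => hle _).trans (hd z))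
      (fun w => ?_)
    simp_rw [id, productKernel_sub_comm C N _ w, enormWeight_sub_comm _ w]
    exact hc w
  · refine lintegral_weighted_le_of_le_lintegral Measure.count volume hP measurable_id hf
      (measurable_productKernel C N) (by positivity) (Nat.cast_nonneg d) (by linarith)
      (fun k => (hdom μ hμ hdiam _).1) (fun z => (lintegral_mono fun k => hle _).trans (hc z))
      (fun w => ?_)
    simp_rw [productKernel_sub_comm C N _ w, enormWeight_sub_comm _ w]
    exact hd w

/-- Polynomial decay of `μ̂` along the lattice `α ℤ^d` extends to all of `ℝ^d`. -/
theorem exists_weighted_sup_comparison (d : ℕ) {R α s : ℝ} (hR : 0 < R) (hα : 0 < α)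
    (hαR : α < 1 / R) (hs : 0 ≤ s) :
    ∃ M : ℝ≥0, ∀ (μ : Measure (EuclideanSpace ℝ (Fin d))) [IsFiniteMeasure μ],
      IsCompact μ.support → Metric.diam μ.support = R → ∀ A : ℝ≥0∞,
        (∀ k, ‖measureFourier μ (scaledLatticePoint α k)‖ₑ *
          enormWeight (scaledLatticePoint α k) ^ s ≤ A) →
        ∀ z, ‖measureFourier μ z‖ₑ * enormWeight z ^ s ≤ A * M := by
  obtain ⟨C, N, M, -, hd, hdom⟩ := exists_productKernel_domination d hR hα hαR hs
  exact ⟨M, fun μ _ hμ hdiam A hA z => weighted_le_of_le_lintegral Measure.count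
    (f := fun z => ‖measureFourier μ z‖ₑ) (measurable_of_countable _)
    (measurable_productKernel C N) hs (hdom μ hμ hdiam z).2 (hd z) hA⟩

/-! ### Lattice sums and homogeneous weights away from the origin -/

lemma scaledLatticePoint_injective {d : ℕ} {α : ℝ} (hα : 0 < α) :
    Function.Injective (scaledLatticePoint α : (Fin d → ℤ) → EuclideanSpace ℝ (Fin d)) := by
  intro k l h
  ext i
  have := congrArg (fun z : EuclideanSpace ℝ (Fin d) => z i) h
  simpa [scaledLatticePoint, hα.ne'] using this

lemma scaledLatticePoint_zero {d : ℕ} (α : ℝ) :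
    scaledLatticePoint α (0 : Fin d → ℤ) = 0 := by
  ext i; simp [scaledLatticePoint]

lemma le_norm_scaledLatticePoint {d : ℕ} {α : ℝ} (hα : 0 < α) {k : Fin d → ℤ} (hk : k ≠ 0) :
    α ≤ ‖scaledLatticePoint α k‖ := by
  obtain ⟨i, hi⟩ := Function.ne_iff.mp hk
  refine le_trans ?_ (PiLp.norm_apply_le (scaledLatticePoint α k) i)
  have h1 : (1 : ℝ) ≤ |(k i : ℝ)| := by exact_mod_cast Int.one_le_abs hi
  change α ≤ ‖α * (k i : ℝ)‖
  rw [Real.norm_eq_abs, abs_mul, abs_of_pos hα]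
  nlinarith

theorem latticeSum_eq_tsum {d : ℕ} {α : ℝ} (hα : 0 < α) (s θ : ℝ)
    (μ : Measure (EuclideanSpace ℝ (Fin d))) :
    latticeSum α s θ μ = ∑' k : Fin d → ℤ, if k = 0 then 0 else
      ‖measureFourier μ (scaledLatticePoint α k)‖ₑ ^ (2 / θ) *
        ‖scaledLatticePoint α k‖ₑ ^ (s / θ - (d : ℝ)) := by
  unfold latticeSum
  rw [tsum_subtype (scaledLattice d α \ {0}) fun z : EuclideanSpace ℝ (Fin d) =>
    ‖measureFourier μ z‖ₑ ^ (2 / θ) * ‖z‖ₑ ^ (s / θ - (d : ℝ)),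
    ← (scaledLatticePoint_injective hα).tsum_eq]
  · refine tsum_congr fun k => ?_
    have h1 : scaledLatticePoint α k ∈ scaledLattice d α := ⟨k, rfl⟩
    have h2 : scaledLatticePoint α k = 0 ↔ k = 0 :=
      ⟨fun h => scaledLatticePoint_injective hα (h.trans (scaledLatticePoint_zero α).symm),
        fun h => h ▸ scaledLatticePoint_zero α⟩
    by_cases hk : k = 0
    · rw [Set.indicator_of_notMem (fun h => h.2 (h2.mpr hk)), if_pos hk]
    · rw [Set.indicator_of_mem (by simp [h1, h2, hk]), if_neg hk]
  · exact Set.support_indicator_subset.trans Set.sdiff_subset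

/-- The mass term becomes the term `k = 0` with weight 1, which is also the inhomogeneous weight at
the origin. -/
theorem add_latticeSum_eq_tsum {d : ℕ} {α : ℝ} (hα : 0 < α) (s θ : ℝ)
    (μ : Measure (EuclideanSpace ℝ (Fin d))) :
    ‖measureFourier μ 0‖ₑ ^ (2 / θ) + latticeSum α s θ μ =
      ∑' k : Fin d → ℤ, ‖measureFourier μ (scaledLatticePoint α k)‖ₑ ^ (2 / θ) *
        (if k = 0 then 1 else ‖scaledLatticePoint α k‖ₑ) ^ (s / θ - (d : ℝ)) := by
  classical
  rw [latticeSum_eq_tsum hα]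
  conv_rhs => rw [ENNReal.tsum_eq_add_tsum_ite (0 : Fin d → ℤ), scaledLatticePoint_zero]
  congr 1
  · simp
  · refine tsum_congr fun k => ?_
    split_ifs <;> rfl

/-- Since `q ≥ 1`, `|sq - d| ≤ (s + d)q`. Comparison losses thus become `q`-th powers of a fixed
constant, harmless after the final `θ`-th power. -/
lemma rpow_abs_sub_le {c : ℝ≥0∞} (hc : 1 ≤ c) {s q : ℝ} (hs : 0 ≤ s) (hq : 1 ≤ q) (d : ℕ) :
    c ^ |s * q - d| ≤ (c ^ (s + d)) ^ q := by
  rw [← ENNReal.rpow_mul]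
  refine ENNReal.rpow_le_rpow_of_exponent_le hc ?_
  have h1 : 0 ≤ s * q := by positivity
  have h2 : (d : ℝ) ≤ d * q := le_mul_of_one_le_right (Nat.cast_nonneg d) hq
  have h3 : (0 : ℝ) ≤ d := Nat.cast_nonneg d
  rw [abs_le]
  constructor <;> nlinarith

lemma enorm_le_enormWeight {E : Type*} [NormedAddCommGroup E] (z : E) : ‖z‖ₑ ≤ enormWeight z :=
  le_add_self

lemma enormWeight_le_enorm_mul {E : Type*} [NormedAddCommGroup E] {r : ℝ} (hr : 0 < r) {z : E}
    (hz : r ≤ ‖z‖) : enormWeight z ≤ ‖z‖ₑ * ENNReal.ofReal (1 + r⁻¹) := by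
  have h : 1 + ‖z‖ ≤ ‖z‖ * (1 + r⁻¹) := by
    have : 1 ≤ ‖z‖ * r⁻¹ := by rwa [← div_eq_mul_inv, one_le_div hr]
    linarith
  have h2 := ENNReal.ofReal_le_ofReal h
  rwa [ENNReal.ofReal_mul (norm_nonneg _), ENNReal.ofReal_add zero_le_one (norm_nonneg _),
    ofReal_norm, ENNReal.ofReal_one] at h2

lemma one_le_ofReal_one_add_inv {r : ℝ} (hr : 0 < r) : 1 ≤ ENNReal.ofReal (1 + r⁻¹) := by
  rw [ENNReal.one_le_ofReal]; simp [hr.le]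

/-- Away from the origin the homogeneous and inhomogeneous weights are comparable. -/
theorem enorm_rpow_le_and_enormWeight_rpow_le {E : Type*} [NormedAddCommGroup E] {r : ℝ}
    (hr : 0 < r) {z : E} (hz : r ≤ ‖z‖) {s q : ℝ} (hs : 0 ≤ s) (hq : 1 ≤ q) (d : ℕ) :
    ‖z‖ₑ ^ (s * q - d) ≤
      enormWeight z ^ (s * q - d) * (ENNReal.ofReal (1 + r⁻¹) ^ (s + d)) ^ q ∧
    enormWeight z ^ (s * q - d) ≤
      ‖z‖ₑ ^ (s * q - d) * (ENNReal.ofReal (1 + r⁻¹) ^ (s + d)) ^ q := by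
  have h1 := one_le_ofReal_one_add_inv hr
  have h2 := enormWeight_le_enorm_mul hr hz
  have h3 : ‖z‖ₑ ≤ enormWeight z * ENNReal.ofReal (1 + r⁻¹) :=
    (enorm_le_enormWeight z).trans (le_mul_of_one_le_right zero_le h1)
  constructor
  · refine (rpow_le_rpow_mul_rpow_abs (enormWeight_ne_top z) h1 ENNReal.ofReal_ne_top
      h3 h2 _).trans ?_
    gcongr
    exact rpow_abs_sub_le h1 hs hq d
  · refine (rpow_le_rpow_mul_rpow_abs enorm_ne_top h1 ENNReal.ofReal_ne_top
      h2 h3 _).trans ?_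
    gcongr
    exact rpow_abs_sub_le h1 hs hq d

theorem tsum_lattice_weight_comparison {d : ℕ} {α s q : ℝ} (hα : 0 < α) (hs : 0 < s) (hq : 1 ≤ q)
    (F : (Fin d → ℤ) → ℝ≥0∞) :
    ∑' k, F k * (if k = 0 then 1 else ‖scaledLatticePoint α k‖ₑ) ^ (s * q - d) ≤
      (ENNReal.ofReal (1 + α⁻¹) ^ (s + d)) ^ q *
        ∑' k, F k * enormWeight (scaledLatticePoint α k) ^ (s * q - d) ∧
    ∑' k, F k * enormWeight (scaledLatticePoint α k) ^ (s * q - d) ≤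
      (ENNReal.ofReal (1 + α⁻¹) ^ (s + d)) ^ q *
        ∑' k, F k * (if k = 0 then 1 else ‖scaledLatticePoint α k‖ₑ) ^ (s * q - d) := by
  have h0 : enormWeight (scaledLatticePoint α (0 : Fin d → ℤ)) = 1 := by
    simp [scaledLatticePoint_zero, enormWeight]
  have h1 : 1 ≤ (ENNReal.ofReal (1 + α⁻¹) ^ (s + d)) ^ q :=
    ENNReal.one_le_rpow (ENNReal.one_le_rpow (one_le_ofReal_one_add_inv hα) (by positivity))
      (by positivity)
  rw [← ENNReal.tsum_mul_left, ← ENNReal.tsum_mul_left]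
  constructor <;> refine ENNReal.tsum_le_tsum fun k => ?_ <;> rw [mul_left_comm] <;>
    gcongr F k * ?_ <;> by_cases hk : k = 0
  · subst hk; simpa [h0] using h1
  · rw [if_neg hk]
    exact (enorm_rpow_le_and_enormWeight_rpow_le hα (le_norm_scaledLatticePoint hα hk)
      hs.le hq d).1.trans_eq (mul_comm _ _)
  · subst hk; simpa [h0] using h1
  · rw [if_neg hk]
    exact (enorm_rpow_le_and_enormWeight_rpow_le hα (le_norm_scaledLatticePoint hα hk)
      hs.le hq d).2.trans_eq (mul_comm _ _)

/-! ### Behaviour near the origin and control of the mass -/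

theorem lintegral_ball_enorm_rpow_lt_top {d : ℕ} (hd : 0 < d) {s : ℝ} (hs : 0 < s) :
    ∫⁻ z in Metric.ball (0 : EuclideanSpace ℝ (Fin d)) 1, ‖z‖ₑ ^ (s - d) < ∞ := by
  have : Nonempty (Fin d) := ⟨⟨0, hd⟩⟩
  have h1 : IntegrableOn (fun z : EuclideanSpace ℝ (Fin d) => ‖z‖ ^ (s - d))
      (Metric.ball 0 1) := by
    -- Polar coordinates: the radial integrand is `y ^ (d-1) * y ^ (s-d) = y ^ (s-1)`, integrable on
    -- `(0, 1)` because `s > 0`.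
    rw [integrableOn_fun_norm_addHaar volume (f := fun y : ℝ => y ^ (s - d))]
    have h2 : IntegrableOn (fun y : ℝ => y ^ (s - 1)) (Set.Ioo 0 1) :=
      (intervalIntegral.integrableOn_Ioo_rpow_iff one_pos).mpr (by linarith)
    refine h2.congr_fun (fun y hy => ?_) measurableSet_Ioo
    simp only [finrank_euclideanSpace, Fintype.card_fin, smul_eq_mul]
    rw [← Real.rpow_natCast, ← Real.rpow_add hy.1, Nat.cast_sub hd]
    congr 1; push_cast; ring
  refine lt_of_le_of_lt (le_of_eq (lintegral_congr_ae ?_)) h1.2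
  -- For `s < d` the power at the origin is 0 in `ℝ` but `∞` in `ℝ≥0∞`, so this null set is
  -- discarded.
  filter_upwards [ae_restrict_of_ae (s := Metric.ball 0 1)
    (compl_mem_ae_iff.mpr (measure_singleton (μ := volume) (0 : EuclideanSpace ℝ (Fin d))))]
    with z hz
  have hz : 0 < ‖z‖ := norm_pos_iff.mpr hz
  rw [Real.enorm_of_nonneg (by positivity), ← ENNReal.ofReal_rpow_of_pos hz, ofReal_norm]

/-- Near the origin `|μ̂|` is at least half of its value at the origin. -/
theorem enorm_measureFourier_zero_le_two_mul {d : ℕ} {R : ℝ} (hR : 0 < R)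
    (μ : Measure (EuclideanSpace ℝ (Fin d))) [IsFiniteMeasure μ] (hμ : IsCompact μ.support)
    (hdiam : Metric.diam μ.support = R) {z : EuclideanSpace ℝ (Fin d)}
    (hz : ‖z‖ ≤ 1 / (4 * Real.pi * R)) :
    ‖measureFourier μ 0‖ₑ ≤ 2 * ‖measureFourier μ z‖ₑ := by
  have hne : μ.support.Nonempty := by
    rw [Set.nonempty_iff_ne_empty]
    rintro h
    rw [h, Metric.diam_empty] at hdiam
    exact hR.ne hdiam
  obtain ⟨a, ha⟩ := hne
  have hint : Integrable (fun x => negFourierChar (inner ℝ (x - a) z)) μ :=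
    (integrable_const (1 : ℝ)).mono'
      (continuous_negFourierChar.comp (by fun_prop)).aestronglyMeasurable
      (Filter.Eventually.of_forall fun x => (norm_negFourierChar _).le)
  have h0 : measureFourier μ 0 = ∫ _x, (1 : ℂ) ∂μ := by simp [measureFourier]
  -- Centred at a point of the support, the phase is at most `2πR‖z‖ ≤ 1/2`, whence the radius
  -- `1/(4πR)`.
  have h1 : ‖(∫ x, negFourierChar (inner ℝ (x - a) z) ∂μ) - measureFourier μ 0‖ ≤
      1 / 2 * μ.real Set.univ := by
    rw [h0, ← integral_sub hint (integrable_const _)]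
    refine norm_integral_le_of_norm_le_const ?_
    filter_upwards [Measure.support_mem_ae (μ := μ)] with x hx
    rw [negFourierChar_eq]
    refine Real.norm_exp_I_mul_ofReal_sub_one_le.trans ?_
    have h2 : |inner ℝ (x - a) z| ≤ R * (1 / (4 * Real.pi * R)) := by
      refine (abs_real_inner_le_norm _ _).trans ?_
      gcongr
      rw [← dist_eq_norm, ← hdiam]
      exact Metric.dist_le_diam_of_mem hμ.isBounded hx ha
    rw [norm_neg, norm_mul, Real.norm_of_nonneg (by positivity), Real.norm_eq_abs]
    calc _ ≤ 2 * Real.pi * (R * (1 / (4 * Real.pi * R))) := by gcongr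
      _ = 1 / 2 := by
        have := Real.pi_pos.ne'
        field_simp; norm_num
  have h3 : ‖∫ x, negFourierChar (inner ℝ (x - a) z) ∂μ‖ = ‖measureFourier μ z‖ := by
    have := enorm_measureFourier_eq μ a z
    rw [← ofReal_norm, ← ofReal_norm, ENNReal.ofReal_eq_ofReal_iff (norm_nonneg _)
      (norm_nonneg _)] at this
    exact this.symm
  have h4 : ‖measureFourier μ 0‖ = μ.real Set.univ := by
    rw [h0]; simp
  have h5 : ‖measureFourier μ 0‖ ≤ 2 * ‖measureFourier μ z‖ := by
    have := norm_sub_norm_le (measureFourier μ 0) (∫ x, negFourierChar (inner ℝ (x - a) z) ∂μ)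
    rw [norm_sub_rev] at this
    linarith
  have := ENNReal.ofReal_le_ofReal h5
  rwa [ENNReal.ofReal_mul zero_le_two, ofReal_norm, ofReal_norm, ENNReal.ofReal_ofNat] at this

/-- Absorbs a fixed factor such as a volume into a `q`-th power, by `a ≤ (1 + a) ^ q` and
superadditivity of `x ↦ x ^ q` for `q ≥ 1`. -/
lemma exists_nnreal_mul_rpow_le_of_le {a b c : ℝ≥0∞} (ha : a ≠ ∞) (hb : b ≠ ∞) (hc : c ≠ ∞) :
    ∃ D : ℝ≥0, ∀ q : ℝ, 1 ≤ q → a * b ^ q + c ^ q ≤ (D : ℝ≥0∞) ^ q := by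
  refine ⟨((1 + a) * b + c).toNNReal, fun q hq => ?_⟩
  rw [ENNReal.coe_toNNReal (by finiteness)]
  have h0 : 0 ≤ q := by linarith
  have h1 : a ≤ (1 + a) ^ q :=
    le_add_self.trans (ENNReal.le_rpow_self_of_one_le le_self_add hq)
  calc _ ≤ (1 + a) ^ q * b ^ q + c ^ q := by gcongr
    _ = ((1 + a) * b) ^ q + c ^ q := by rw [ENNReal.mul_rpow_of_nonneg _ _ h0]
    _ ≤ _ := ENNReal.add_rpow_le_rpow_add _ _ hq

/-- The homogeneous energy integral is controlled by the inhomogeneous one and the total mass. -/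
theorem exists_lintegral_enorm_le {d : ℕ} (hd : 0 < d) {s : ℝ} (hs : 0 < s) :
    ∃ D : ℝ≥0, ∀ (μ : Measure (EuclideanSpace ℝ (Fin d))) [IsFiniteMeasure μ], ∀ q : ℝ, 1 ≤ q →
      ∫⁻ z, ‖measureFourier μ z‖ₑ ^ (2 * q) * ‖z‖ₑ ^ (s * q - d) ≤
        (D : ℝ≥0∞) ^ q * (‖measureFourier μ 0‖ₑ ^ (2 * q) +
          ∫⁻ z, ‖measureFourier μ z‖ₑ ^ (2 * q) * enormWeight z ^ (s * q - d)) := by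
  set B := ∫⁻ z in Metric.ball (0 : EuclideanSpace ℝ (Fin d)) 1, ‖z‖ₑ ^ (s - d) with hB
  have hBfin : B ≠ ∞ := (lintegral_ball_enorm_rpow_lt_top hd hs).ne
  set A : ℝ≥0∞ := ENNReal.ofReal (1 + (1 : ℝ)⁻¹) ^ (s + d) with hA
  have hAfin : A ≠ ∞ := ENNReal.rpow_ne_top_of_nonneg (by positivity) ENNReal.ofReal_ne_top
  obtain ⟨D, hD⟩ := exists_nnreal_mul_rpow_le_of_le hBfin ENNReal.one_ne_top hAfin
  refine ⟨D, fun μ _ q hq => ?_⟩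
  have hf : Measurable fun z => ‖measureFourier μ z‖ₑ :=
    (continuous_measureFourier μ).measurable.enorm
  have hDq := hD q hq
  rw [ENNReal.one_rpow, mul_one] at hDq
  rw [← lintegral_add_compl _ (measurableSet_ball (x := (0 : EuclideanSpace ℝ (Fin d))) (ε := 1)),
    mul_add]
  refine add_le_add ?_ ?_
  -- On the unit ball `|z|^(sq-d) ≤ |z|^(s-d)`, an integrable majorant independent of `q`.
  · calc _ ≤ ∫⁻ z in Metric.ball (0 : EuclideanSpace ℝ (Fin d)) 1,
          ‖measureFourier μ 0‖ₑ ^ (2 * q) * ‖z‖ₑ ^ (s - d) := by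
          refine setLIntegral_mono' measurableSet_ball fun z hz => ?_
          refine mul_le_mul' (ENNReal.rpow_le_rpow ?_ (by linarith))
            (ENNReal.rpow_le_rpow_of_exponent_ge ?_ ?_)
          · rw [enorm_measureFourier_zero]; exact enorm_measureFourier_le μ z
          · rw [← ofReal_norm, ENNReal.ofReal_le_one]
            exact (mem_ball_zero_iff.mp hz).le
          · nlinarith
      _ = B * ‖measureFourier μ 0‖ₑ ^ (2 * q) := by
          rw [lintegral_const_mul _ (by fun_prop), mul_comm]
      _ ≤ _ := by gcongr; exact le_self_add.trans hDq
  · calc _ ≤ ∫⁻ z in (Metric.ball (0 : EuclideanSpace ℝ (Fin d)) 1)ᶜ,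
          A ^ q * (‖measureFourier μ z‖ₑ ^ (2 * q) * enormWeight z ^ (s * q - d)) := by
          refine setLIntegral_mono' measurableSet_ball.compl fun z hz => ?_
          rw [mul_left_comm]
          have hz : 1 ≤ ‖z‖ := by simpa using hz
          refine mul_le_mul' le_rfl ?_
          exact (enorm_rpow_le_and_enormWeight_rpow_le one_pos hz hs.le hq d).1.trans_eq
            (mul_comm _ _)
      _ ≤ ∫⁻ z, A ^ q * (‖measureFourier μ z‖ₑ ^ (2 * q) * enormWeight z ^ (s * q - d)) :=
          setLIntegral_le_lintegral _ _
      _ = A ^ q * ∫⁻ z, ‖measureFourier μ z‖ₑ ^ (2 * q) * enormWeight z ^ (s * q - d) :=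
          lintegral_const_mul _ (by fun_prop)
      _ ≤ _ := by gcongr ?_ * _; exact le_add_self.trans hDq

/-- The total mass is controlled by the homogeneous energy integral. -/
theorem exists_enorm_measureFourier_zero_rpow_le {d : ℕ} (hd : 0 < d) {R s : ℝ} (hR : 0 < R)
    (hs : 0 < s) :
    ∃ D : ℝ≥0, ∀ (μ : Measure (EuclideanSpace ℝ (Fin d))) [IsFiniteMeasure μ],
      IsCompact μ.support → Metric.diam μ.support = R → ∀ q : ℝ, 1 ≤ q →
      ‖measureFourier μ 0‖ₑ ^ (2 * q) ≤
        (D : ℝ≥0∞) ^ q * ∫⁻ z, ‖measureFourier μ z‖ₑ ^ (2 * q) * ‖z‖ₑ ^ (s * q - d) := by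
  have : Nonempty (Fin d) := ⟨⟨0, hd⟩⟩
  set r : ℝ := min 1 (1 / (4 * Real.pi * R)) with hr
  have hr0 : 0 < r := by rw [hr]; positivity
  have hr1 : r ≤ 1 := min_le_left _ _
  -- The energy is bounded below on an annulus, where `|z|` is within a factor `2/r` of 1 and the
  -- weight is controlled whatever the sign of its exponent.
  set U : Set (EuclideanSpace ℝ (Fin d)) := Metric.ball 0 r ∩ (Metric.closedBall 0 (r / 2))ᶜ with hU
  have hUo : IsOpen U := Metric.isOpen_ball.inter Metric.isClosed_closedBall.isOpen_compl
  have hUne : U.Nonempty := by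
    obtain ⟨x, hx⟩ := exists_norm_eq (EuclideanSpace ℝ (Fin d)) (show 0 ≤ 3 * r / 4 by positivity)
    refine ⟨x, ?_, ?_⟩
    · rw [mem_ball_zero_iff, hx]; linarith
    · rw [Set.mem_compl_iff, mem_closedBall_zero_iff, hx]; linarith
  have hv : volume U ≠ 0 := (hUo.measure_pos volume hUne).ne'
  have hvtop : volume U ≠ ∞ :=
    ((measure_mono Set.inter_subset_left).trans_lt measure_ball_lt_top).ne
  set c : ℝ≥0∞ := ENNReal.ofReal (2 / r) with hc
  have hc1 : 1 ≤ c := by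
    rw [hc, ENNReal.one_le_ofReal, le_div_iff₀ hr0]; linarith
  have hcfin : (c : ℝ≥0∞) ≠ ∞ := ENNReal.ofReal_ne_top
  have hA : (4 : ℝ≥0∞) * c ^ (s + d) ≠ ∞ :=
    ENNReal.mul_ne_top (by simp) (ENNReal.rpow_ne_top_of_nonneg (by positivity) hcfin)
  obtain ⟨D, hD⟩ := exists_nnreal_mul_rpow_le_of_le (ENNReal.inv_ne_top.mpr hv) hA
    ENNReal.zero_ne_top
  refine ⟨D, fun μ _ hμ hdiam q hq => ?_⟩
  have hq0 : 0 ≤ q := by linarith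
  have hf : Measurable fun z => ‖measureFourier μ z‖ₑ :=
    (continuous_measureFourier μ).measurable.enorm
  have hpt : ∀ z ∈ U, ‖measureFourier μ 0‖ₑ ^ (2 * q) ≤ (4 * c ^ (s + d)) ^ q *
      (‖measureFourier μ z‖ₑ ^ (2 * q) * ‖z‖ₑ ^ (s * q - d)) := by
    rintro z ⟨hz1, hz2⟩
    rw [mem_ball_zero_iff] at hz1
    rw [Set.mem_compl_iff, mem_closedBall_zero_iff, not_le] at hz2
    have h1 := ENNReal.rpow_le_rpow (enorm_measureFourier_zero_le_two_mul hR μ hμ hdiam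
      (hz1.le.trans (min_le_right _ _))) (show 0 ≤ 2 * q by positivity)
    have h2 : (1 : ℝ≥0∞) ≤ ‖z‖ₑ * c := by
      rw [← ofReal_norm, hc, ← ENNReal.ofReal_mul (norm_nonneg _), ENNReal.one_le_ofReal,
        ← mul_div_assoc, le_div_iff₀ hr0]
      linarith
    have h3 : ‖z‖ₑ ≤ 1 * c := by
      rw [one_mul]
      refine le_trans ?_ hc1
      rw [← ofReal_norm, ENNReal.ofReal_le_one]
      linarith
    have h4 := rpow_le_rpow_mul_rpow_abs enorm_ne_top hc1 hcfin h2 h3 (s * q - d)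
    rw [ENNReal.one_rpow] at h4
    have h5 := h4.trans (mul_le_mul' le_rfl (rpow_abs_sub_le hc1 hs.le hq d))
    have h6 : (2 : ℝ≥0∞) ^ (2 * q) = 4 ^ q := by
      rw [ENNReal.rpow_mul]; norm_num
    rw [ENNReal.mul_rpow_of_nonneg _ _ (by positivity), h6] at h1
    calc _ ≤ 4 ^ q * ‖measureFourier μ z‖ₑ ^ (2 * q) * 1 := by rwa [mul_one]
      _ ≤ 4 ^ q * ‖measureFourier μ z‖ₑ ^ (2 * q) * (‖z‖ₑ ^ (s * q - d) * (c ^ (s + d)) ^ q) := by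
          gcongr
      _ = _ := by rw [ENNReal.mul_rpow_of_nonneg _ _ hq0]; ring
  have hint : ‖measureFourier μ 0‖ₑ ^ (2 * q) * volume U ≤ (4 * c ^ (s + d)) ^ q *
      ∫⁻ z, ‖measureFourier μ z‖ₑ ^ (2 * q) * ‖z‖ₑ ^ (s * q - d) := by
    rw [← setLIntegral_const, ← lintegral_const_mul _ (by fun_prop)]
    exact (setLIntegral_mono' hUo.measurableSet hpt).trans (setLIntegral_le_lintegral _ _)
  calc _ = ‖measureFourier μ 0‖ₑ ^ (2 * q) * volume U * (volume U)⁻¹ := by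
        rw [mul_assoc, ENNReal.mul_inv_cancel hv hvtop, mul_one]
    _ ≤ (4 * c ^ (s + d)) ^ q *
        (∫⁻ z, ‖measureFourier μ z‖ₑ ^ (2 * q) * ‖z‖ₑ ^ (s * q - d)) * (volume U)⁻¹ := by gcongr
    _ = (volume U)⁻¹ * (4 * c ^ (s + d)) ^ q *
        ∫⁻ z, ‖measureFourier μ z‖ₑ ^ (2 * q) * ‖z‖ₑ ^ (s * q - d) := by ring
    _ ≤ _ := by gcongr; exact le_self_add.trans (hD q hq)

/-- The inhomogeneous energy integral is controlled by the homogeneous one and the total mass. -/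
theorem exists_lintegral_enormWeight_le {d : ℕ} {s : ℝ} (hs : 0 < s) :
    ∃ D : ℝ≥0, ∀ (μ : Measure (EuclideanSpace ℝ (Fin d))) [IsFiniteMeasure μ], ∀ q : ℝ, 1 ≤ q →
      ∫⁻ z, ‖measureFourier μ z‖ₑ ^ (2 * q) * enormWeight z ^ (s * q - d) ≤
        (D : ℝ≥0∞) ^ q * (‖measureFourier μ 0‖ₑ ^ (2 * q) +
          ∫⁻ z, ‖measureFourier μ z‖ₑ ^ (2 * q) * ‖z‖ₑ ^ (s * q - d)) := by
  set A : ℝ≥0∞ := ENNReal.ofReal (1 + (1 : ℝ)⁻¹) ^ (s + d) with hA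
  have hA1 : 1 ≤ ENNReal.ofReal (1 + (1 : ℝ)⁻¹) := one_le_ofReal_one_add_inv one_pos
  have hAfin : A ≠ ∞ := ENNReal.rpow_ne_top_of_nonneg (by positivity) ENNReal.ofReal_ne_top
  have hvol : volume (Metric.ball (0 : EuclideanSpace ℝ (Fin d)) 1) ≠ ∞ := measure_ball_lt_top.ne
  obtain ⟨D, hD⟩ := exists_nnreal_mul_rpow_le_of_le hvol hAfin hAfin
  refine ⟨D, fun μ _ q hq => ?_⟩
  have hf : Measurable fun z => ‖measureFourier μ z‖ₑ :=
    (continuous_measureFourier μ).measurable.enorm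
  have hDq := hD q hq
  rw [← lintegral_add_compl _ (measurableSet_ball (x := (0 : EuclideanSpace ℝ (Fin d))) (ε := 1)),
    mul_add]
  refine add_le_add ?_ ?_
  · calc _ ≤ ∫⁻ z in Metric.ball (0 : EuclideanSpace ℝ (Fin d)) 1,
          ‖measureFourier μ 0‖ₑ ^ (2 * q) * A ^ q := by
          refine setLIntegral_mono' measurableSet_ball fun z hz => ?_
          refine mul_le_mul' (ENNReal.rpow_le_rpow ?_ (by linarith)) ?_
          · rw [enorm_measureFourier_zero]; exact enorm_measureFourier_le μ z
          · have h1 : enormWeight z ≤ 1 * ENNReal.ofReal (1 + (1 : ℝ)⁻¹) := by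
              rw [ENNReal.ofReal_add zero_le_one (by norm_num), enormWeight, ← ofReal_norm, inv_one,
                ENNReal.ofReal_one, one_mul]
              gcongr
              rw [ENNReal.ofReal_le_one]
              exact (mem_ball_zero_iff.mp hz).le
            have h2 : (1 : ℝ≥0∞) ≤ enormWeight z * ENNReal.ofReal (1 + (1 : ℝ)⁻¹) :=
              (one_le_enormWeight z).trans (le_mul_of_one_le_right zero_le hA1)
            have h3 := rpow_le_rpow_mul_rpow_abs ENNReal.one_ne_top hA1 ENNReal.ofReal_ne_top h1 h2
              (s * q - d)
            rw [ENNReal.one_rpow, one_mul] at h3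
            exact h3.trans (rpow_abs_sub_le hA1 hs.le hq d)
      _ = volume (Metric.ball (0 : EuclideanSpace ℝ (Fin d)) 1) * A ^ q *
          ‖measureFourier μ 0‖ₑ ^ (2 * q) := by
          rw [setLIntegral_const]; ring
      _ ≤ _ := by gcongr; exact le_self_add.trans hDq
  · calc _ ≤ ∫⁻ z in (Metric.ball (0 : EuclideanSpace ℝ (Fin d)) 1)ᶜ,
          A ^ q * (‖measureFourier μ z‖ₑ ^ (2 * q) * ‖z‖ₑ ^ (s * q - d)) := by
          refine setLIntegral_mono' measurableSet_ball.compl fun z hz => ?_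
          rw [mul_left_comm]
          have hz : 1 ≤ ‖z‖ := by simpa using hz
          refine mul_le_mul' le_rfl ?_
          exact (enorm_rpow_le_and_enormWeight_rpow_le one_pos hz hs.le hq d).2.trans_eq
            (mul_comm _ _)
      _ ≤ ∫⁻ z, A ^ q * (‖measureFourier μ z‖ₑ ^ (2 * q) * ‖z‖ₑ ^ (s * q - d)) :=
          setLIntegral_le_lintegral _ _
      _ = A ^ q * ∫⁻ z, ‖measureFourier μ z‖ₑ ^ (2 * q) * ‖z‖ₑ ^ (s * q - d) :=
          lintegral_const_mul _ (by fun_prop)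
      _ ≤ _ := by gcongr ?_ * _; exact le_add_self.trans hDq

/-! ### The energy comparison -/

/-- Two-sided comparison of the energy integral with its discretization, before taking roots. -/
theorem exists_energy_comparison {d : ℕ} (hd : 0 < d) {R α s : ℝ} (hR : 0 < R) (hα : 0 < α)
    (hαR : α < 1 / R) (hs : 0 < s) :
    ∃ D : ℝ≥0, ∀ (μ : Measure (EuclideanSpace ℝ (Fin d))) [IsFiniteMeasure μ],
      IsCompact μ.support → Metric.diam μ.support = R → ∀ θ : ℝ, 0 < θ → θ ≤ 1 →
        ∫⁻ z, ‖measureFourier μ z‖ₑ ^ (2 / θ) * ‖z‖ₑ ^ (s / θ - (d : ℝ)) ≤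
          (D : ℝ≥0∞) ^ θ⁻¹ * (‖measureFourier μ 0‖ₑ ^ (2 / θ) + latticeSum α s θ μ) ∧
        ‖measureFourier μ 0‖ₑ ^ (2 / θ) + latticeSum α s θ μ ≤
          (D : ℝ≥0∞) ^ θ⁻¹ *
            ∫⁻ z, ‖measureFourier μ z‖ₑ ^ (2 / θ) * ‖z‖ₑ ^ (s / θ - (d : ℝ)) := by
  obtain ⟨M, hM⟩ := exists_weighted_lintegral_comparison d hR hα hαR hs
  obtain ⟨D₁, hD₁⟩ := exists_lintegral_enorm_le hd hs
  obtain ⟨D₂, hD₂⟩ := exists_enorm_measureFourier_zero_rpow_le hd hR hs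
  obtain ⟨D₃, hD₃⟩ := exists_lintegral_enormWeight_le (d := d) hs
  set A : ℝ≥0∞ := ENNReal.ofReal (1 + α⁻¹) ^ (s + d) with hA
  have hAfin : A ≠ ∞ := ENNReal.rpow_ne_top_of_nonneg (by positivity) ENNReal.ofReal_ne_top
  obtain ⟨E₁, hE₁⟩ := exists_nnreal_mul_rpow_le_of_le (a := 1) (b := D₁) (c := D₁ * (M * A))
    (by finiteness) (by finiteness) (by finiteness)
  obtain ⟨E₂, hE₂⟩ := exists_nnreal_mul_rpow_le_of_le (a := 1) (b := A * (M * D₃))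
    (c := A * (M * D₃) * D₂) (by finiteness) (by finiteness) (by finiteness)
  refine ⟨max E₁ E₂, fun μ _ hμ hdiam θ hθ hθ1 => ?_⟩
  set q := θ⁻¹ with hqd
  have hq : 1 ≤ q := (one_le_inv₀ hθ).mpr hθ1
  have hq0 : 0 ≤ q := by linarith
  rw [add_latticeSum_eq_tsum hα]
  have hf0 : ‖measureFourier μ 0‖ₑ ^ (2 / θ) ≤ ∑' k : Fin d → ℤ,
      ‖measureFourier μ (scaledLatticePoint α k)‖ₑ ^ (2 / θ) *
        (if k = 0 then 1 else ‖scaledLatticePoint α k‖ₑ) ^ (s / θ - (d : ℝ)) := by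
    rw [← add_latticeSum_eq_tsum hα]; exact le_self_add
  simp only [div_eq_mul_inv, ← hqd] at hf0 ⊢
  obtain ⟨hM1, hM2⟩ := hM μ hμ hdiam q hq
  obtain ⟨hA1, hA2⟩ := tsum_lattice_weight_comparison hα hs hq
    (fun k : Fin d → ℤ => ‖measureFourier μ (scaledLatticePoint α k)‖ₑ ^ (2 * q))
  have h1 := hD₁ μ q hq
  have h2 := hD₂ μ hμ hdiam q hq
  have h3 := hD₃ μ q hq
  set J := ∫⁻ z, ‖measureFourier μ z‖ₑ ^ (2 * q) * ‖z‖ₑ ^ (s * q - d)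
  set I := ∫⁻ z, ‖measureFourier μ z‖ₑ ^ (2 * q) * enormWeight z ^ (s * q - d)
  set S := ∑' k : Fin d → ℤ, ‖measureFourier μ (scaledLatticePoint α k)‖ₑ ^ (2 * q) *
    (if k = 0 then 1 else ‖scaledLatticePoint α k‖ₑ) ^ (s * q - d)
  set T := ∑' k : Fin d → ℤ, ‖measureFourier μ (scaledLatticePoint α k)‖ₑ ^ (2 * q) *
    enormWeight (scaledLatticePoint α k) ^ (s * q - d)
  set F := ‖measureFourier μ 0‖ₑ ^ (2 * q)
  constructor
  · calc J ≤ (D₁ : ℝ≥0∞) ^ q * (S + (M : ℝ≥0∞) ^ q * (A ^ q * S)) := by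
          refine h1.trans ?_
          gcongr
          exact hM1.trans (by gcongr)
      _ = (1 * (D₁ : ℝ≥0∞) ^ q + (D₁ * (M * A)) ^ q) * S := by
          rw [ENNReal.mul_rpow_of_nonneg _ _ hq0, ENNReal.mul_rpow_of_nonneg _ _ hq0]; ring
      _ ≤ (E₁ : ℝ≥0∞) ^ q * S := by gcongr ?_ * _; exact hE₁ q hq
      _ ≤ _ := by gcongr; exact le_max_left _ _
  -- The mass produced by passing from `I` to `J` is reabsorbed into `J` by `h2`.
  · calc S ≤ A ^ q * ((M : ℝ≥0∞) ^ q * ((D₃ : ℝ≥0∞) ^ q * ((D₂ : ℝ≥0∞) ^ q * J + J))) := by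
          exact hA1.trans (mul_le_mul' le_rfl (hM2.trans (mul_le_mul' le_rfl
            (h3.trans (mul_le_mul' le_rfl (add_le_add h2 le_rfl))))))
      _ = (1 * (A * (M * D₃)) ^ q + (A * (M * D₃) * D₂) ^ q) * J := by
          simp only [ENNReal.mul_rpow_of_nonneg _ _ hq0]
          ring
      _ ≤ (E₂ : ℝ≥0∞) ^ q * J := by gcongr ?_ * _; exact hE₂ q hq
      _ ≤ _ := by gcongr; exact le_max_right _ _

lemma rpow_le_mul_rpow_of_le_rpow_inv_mul {a b c : ℝ≥0∞} {θ : ℝ} (hθ : 0 < θ)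
    (h : a ≤ c ^ θ⁻¹ * b) : a ^ θ ≤ c * b ^ θ := by
  have := ENNReal.rpow_le_rpow h hθ.le
  rwa [ENNReal.mul_rpow_of_nonneg _ _ hθ.le, ENNReal.rpow_inv_rpow hθ.ne'] at this

theorem exists_fourierEnergy_comparison {d : ℕ} (hd : 0 < d) {R α s : ℝ} (hR : 0 < R) (hα : 0 < α)
    (hαR : α < 1 / R) (hs : 0 < s) :
    ∃ C : ℝ≥0, 0 < C ∧
      ∀ (μ : Measure (EuclideanSpace ℝ (Fin d))) [IsFiniteMeasure μ],
        IsCompact μ.support → Metric.diam μ.support = R →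
        ∀ θ : ℝ, 0 < θ → θ ≤ 1 →
          fourierEnergy s θ μ ≤ (C : ℝ≥0∞) * latticeEnergy α s θ μ ∧
          latticeEnergy α s θ μ ≤ (C : ℝ≥0∞) * fourierEnergy s θ μ := by
  obtain ⟨D, hD⟩ := exists_energy_comparison hd hR hα hαR hs
  refine ⟨D + 1, by positivity, fun μ _ hμ hdiam θ hθ hθ1 => ?_⟩
  obtain ⟨h1, h2⟩ := hD μ hμ hdiam θ hθ hθ1
  have hDle : (D : ℝ≥0∞) ≤ ((D + 1 : ℝ≥0) : ℝ≥0∞) := by exact_mod_cast le_self_add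
  exact ⟨(rpow_le_mul_rpow_of_le_rpow_inv_mul hθ h1).trans (mul_le_mul' hDle le_rfl),
    (rpow_le_mul_rpow_of_le_rpow_inv_mul hθ h2).trans (mul_le_mul' hDle le_rfl)⟩

/-! ### Formulas for the spectrum and the dimension -/

/-- A supremum over nonnegative parameters agrees with one over real parameters if the conditions
agree for positive parameters and the latter supremum is nonnegative. -/
theorem coe_iSup_eq_sSup_image_coe {P : ℝ → Prop} {Q : ℝ≥0 → Prop}
    (hPQ : ∀ s : ℝ≥0, 0 < s → (Q s ↔ P s))
    (h0 : 0 ≤ sSup ((fun s : ℝ => (s : EReal)) '' {s | P s})) :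
    ((⨆ (s : ℝ≥0) (_ : Q s), (s : ℝ≥0∞) : ℝ≥0∞) : EReal) =
      sSup ((fun s : ℝ => (s : EReal)) '' {s | P s}) := by
  have hcoe (s : ℝ≥0) : ((s : ℝ≥0∞) : EReal) = ((s : ℝ) : EReal) := rfl
  apply le_antisymm
  · rw [← EReal.coe_toENNReal h0, EReal.coe_ennreal_le_coe_ennreal_iff]
    refine iSup₂_le fun s hs => ?_
    rcases eq_or_ne s 0 with rfl | hs0
    · simp
    · rw [← EReal.coe_ennreal_le_coe_ennreal_iff, EReal.coe_toENNReal h0, hcoe]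
      exact le_sSup ⟨(s : ℝ), (hPQ s (pos_iff_ne_zero.mpr hs0)).mp hs, rfl⟩
  · refine sSup_le ?_
    rintro _ ⟨s, hs, rfl⟩
    rcases le_or_gt s 0 with h | h
    · exact (EReal.coe_nonpos.mpr h).trans (EReal.coe_ennreal_nonneg _)
    · lift s to ℝ≥0 using h.le
      change ((s : ℝ) : EReal) ≤ _
      rw [← hcoe, EReal.coe_ennreal_le_coe_ennreal_iff]
      exact le_iSup₂_of_le s ((hPQ s (by exact_mod_cast h)).mpr hs) le_rfl

/-- Each coordinate weight is at most the full one; giving each coordinate the exponent `-r/d`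
factors the sum into one-dimensional series, convergent since `r/d > 1`. -/
theorem tsum_enormWeight_scaledLatticePoint_rpow_lt_top {d : ℕ} (hd : 0 < d) {α r : ℝ} (hα : 0 < α)
    (hr : d < r) :
    ∑' k : Fin d → ℤ, enormWeight (scaledLatticePoint α k) ^ (-r) < ∞ := by
  have hd' : (0 : ℝ) < d := by exact_mod_cast hd
  obtain ⟨B, hB⟩ := exists_tsum_enormWeight_sub_mul_int_rpow_le
    ((one_lt_div hd').mpr hr) hα
  have hsum : ∑' n : ℤ, enormWeight (α * (n : ℝ)) ^ (-(r / d)) ≤ B := by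
    refine (le_of_eq (tsum_congr fun n => ?_)).trans (hB 0)
    rw [enormWeight_sub_comm, sub_zero]
  have hpt (k : Fin d → ℤ) : enormWeight (scaledLatticePoint α k) ^ (-r) ≤
      ∏ i, enormWeight (α * (k i : ℝ)) ^ (-(r / d)) := by
    calc _ = ∏ _i : Fin d, enormWeight (scaledLatticePoint α k) ^ (-(r / d)) := by
          rw [Finset.prod_const, Finset.card_univ, Fintype.card_fin, ← ENNReal.rpow_natCast,
            ← ENNReal.rpow_mul]
          congr 1; field_simp
      _ ≤ _ := by
          refine Finset.prod_le_prod' fun i _ => ?_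
          rw [ENNReal.rpow_neg, ENNReal.rpow_neg, ENNReal.inv_le_inv]
          exact ENNReal.rpow_le_rpow (enormWeight_apply_le (scaledLatticePoint α k) i)
            (by have := hd'.trans hr; positivity)
  calc _ ≤ ∑' k : Fin d → ℤ, ∏ i, enormWeight (α * (k i : ℝ)) ^ (-(r / d)) :=
        ENNReal.tsum_le_tsum hpt
    _ = ∏ _i : Fin d, ∑' n : ℤ, enormWeight (α * (n : ℝ)) ^ (-(r / d)) := by
        simp_rw [← lintegral_count]
        rw [← pi_count_eq_count, lintegral_pi_prod_eq_prod_lintegral Measure.count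
          (fun _ (n : ℤ) => enormWeight (α * (n : ℝ)) ^ (-(r / d)))
          (fun _ => measurable_of_countable _)]
    _ ≤ ∏ _i : Fin d, (B : ℝ≥0∞) := Finset.prod_le_prod' fun _ _ => hsum
    _ < ∞ := by simp

/-- The transform is bounded and the exponent `s/θ - d` lies below `-d`. -/
theorem latticeSum_lt_top_of_neg {d : ℕ} (hd : 0 < d) {α s θ : ℝ} (hα : 0 < α) (hs : s < 0)
    (hθ : 0 < θ) (μ : Measure (EuclideanSpace ℝ (Fin d))) [IsFiniteMeasure μ] :
    latticeSum α s θ μ < ∞ := by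
  have hneg : s / θ < 0 := div_neg_of_neg_of_pos hs hθ
  have hd0 : (0 : ℝ) ≤ d := Nat.cast_nonneg d
  set e := s / θ - (d : ℝ) with he
  set c := ENNReal.ofReal (1 + α⁻¹) with hc
  have hc1 : 1 ≤ c := one_le_ofReal_one_add_inv hα
  have hμ : μ Set.univ ^ (2 / θ) ≠ ∞ :=
    ENNReal.rpow_ne_top_of_nonneg (by positivity) (measure_ne_top _ _)
  have hce : c ^ |e| ≠ ∞ := ENNReal.rpow_ne_top_of_nonneg (abs_nonneg _) ENNReal.ofReal_ne_top
  have hfin := tsum_enormWeight_scaledLatticePoint_rpow_lt_top hd hα (r := -e) (by linarith)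
  rw [neg_neg] at hfin
  rw [latticeSum_eq_tsum hα]
  refine lt_of_le_of_lt (ENNReal.tsum_le_tsum (g := fun k => μ Set.univ ^ (2 / θ) * c ^ |e| *
    enormWeight (scaledLatticePoint α k) ^ e) fun k => ?_) ?_
  · split_ifs with hk
    · exact zero_le
    · rw [mul_assoc]
      refine mul_le_mul' (ENNReal.rpow_le_rpow (enorm_measureFourier_le μ _) (by positivity)) ?_
      have h1 := enormWeight_le_enorm_mul hα (le_norm_scaledLatticePoint hα hk)
      have h2 : ‖scaledLatticePoint α k‖ₑ ≤ enormWeight (scaledLatticePoint α k) * c :=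
        (enorm_le_enormWeight _).trans (le_mul_of_one_le_right zero_le hc1)
      exact (rpow_le_rpow_mul_rpow_abs (enormWeight_ne_top _) hc1 ENNReal.ofReal_ne_top
        h2 h1 e).trans_eq (mul_comm _ _)
  · rw [ENNReal.tsum_mul_left]
    exact ENNReal.mul_lt_top (ENNReal.mul_lt_top hμ.lt_top hce.lt_top) hfin

lemma zero_le_sSup_image_coe_of_forall_neg {P : ℝ → Prop} (h : ∀ s < 0, P s) :
    0 ≤ sSup ((fun s : ℝ => (s : EReal)) '' {s | P s}) := by
  refine le_of_forall_lt fun c hc => ?_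
  obtain ⟨x, hx1, hx2⟩ := EReal.lt_iff_exists_real_btwn.mp hc
  exact hx1.trans_le (le_sSup ⟨x, h x (by exact_mod_cast hx2), rfl⟩)

theorem fourierSpectrum_eq_sSup_latticeSum {d : ℕ} (hd : 0 < d) {R α : ℝ} (hR : 0 < R)
    (hα : 0 < α) (hαR : α < 1 / R) (μ : Measure (EuclideanSpace ℝ (Fin d))) [IsFiniteMeasure μ]
    (hμ : IsCompact μ.support) (hdiam : Metric.diam μ.support = R) {θ : ℝ} (hθ : 0 < θ)
    (hθ1 : θ ≤ 1) :
    ((fourierSpectrum θ μ : ℝ≥0∞) : EReal) =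
      sSup ((fun s : ℝ => (s : EReal)) '' {s : ℝ | latticeSum α s θ μ < ∞}) := by
  refine coe_iSup_eq_sSup_image_coe (P := fun s => latticeSum α s θ μ < ∞) (fun s hs => ?_)
    (zero_le_sSup_image_coe_of_forall_neg fun s hs => latticeSum_lt_top_of_neg hd hα hs hθ μ)
  obtain ⟨C, -, hC⟩ := exists_fourierEnergy_comparison hd hR hα hαR (NNReal.coe_pos.mpr hs)
  obtain ⟨h1, h2⟩ := hC μ hμ hdiam θ hθ hθ1
  have h3 : latticeEnergy α s θ μ < ∞ ↔ latticeSum α s θ μ < ∞ := by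
    unfold latticeEnergy
    have hfin : ‖measureFourier μ 0‖ₑ ^ (2 / θ) < ∞ :=
      (ENNReal.rpow_ne_top_of_nonneg (by positivity) enorm_ne_top).lt_top
    rw [ENNReal.rpow_lt_top_iff_of_pos hθ, ENNReal.add_lt_top]
    simp [hfin]
  rw [← h3]
  exact ⟨fun h => h2.trans_lt (ENNReal.mul_lt_top ENNReal.coe_lt_top h),
    fun h => h1.trans_lt (ENNReal.mul_lt_top ENNReal.coe_lt_top h)⟩

theorem fourierDimension_eq_sSup_lattice {d : ℕ} {R α : ℝ} (hR : 0 < R)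
    (hα : 0 < α) (hαR : α < 1 / R) (μ : Measure (EuclideanSpace ℝ (Fin d))) [IsFiniteMeasure μ]
    (hμ : IsCompact μ.support) (hdiam : Metric.diam μ.support = R) :
    ((fourierDimension μ : ℝ≥0∞) : EReal) =
      sSup ((fun s : ℝ => (s : EReal)) '' {s : ℝ | (⨆ z ∈ scaledLattice d α,
        ‖measureFourier μ z‖ₑ ^ (2 : ℝ) * ‖z‖ₑ ^ s) < ∞}) := by
  have hbdd (z : EuclideanSpace ℝ (Fin d)) : ‖measureFourier μ z‖ₑ ≤ μ Set.univ :=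
    enorm_measureFourier_le μ z
  have hfin : μ Set.univ ≠ ∞ := measure_ne_top _ _
  refine coe_iSup_eq_sSup_image_coe (P := fun s => (⨆ z ∈ scaledLattice d α,
    ‖measureFourier μ z‖ₑ ^ (2 : ℝ) * ‖z‖ₑ ^ s) < ∞) (fun s hs => ?_) ?_
  · have hs' : (0 : ℝ) < s := NNReal.coe_pos.mpr hs
    constructor
    · rintro ⟨c, -, hc⟩
      refine lt_of_le_of_lt (iSup₂_le (a := (c : ℝ≥0∞) ^ (2 : ℝ)) fun z _ => ?_) (by finiteness)
      rcases eq_or_ne z 0 with rfl | hz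
      · simp [ENNReal.zero_rpow_of_pos hs']
      · have hz0 : ‖z‖ₑ ≠ 0 := by simpa using hz
        calc _ ≤ ((c : ℝ≥0∞) * ‖z‖ₑ ^ (-((s : ℝ) / 2))) ^ (2 : ℝ) * ‖z‖ₑ ^ (s : ℝ) := by
              gcongr; exact hc z
          _ = (c : ℝ≥0∞) ^ (2 : ℝ) * ‖z‖ₑ ^ (-((s : ℝ) / 2) * 2 + s) := by
              rw [ENNReal.mul_rpow_of_nonneg _ _ zero_le_two, ← ENNReal.rpow_mul, mul_assoc,
                ENNReal.rpow_add _ _ hz0 enorm_ne_top]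
          _ ≤ _ := by
              rw [show -((s : ℝ) / 2) * 2 + s = 0 by ring, ENNReal.rpow_zero, mul_one]
    · intro h
      set T := ⨆ z ∈ scaledLattice d α, ‖measureFourier μ z‖ₑ ^ (2 : ℝ) * ‖z‖ₑ ^ (s : ℝ) with hT
      obtain ⟨M, hM⟩ := exists_weighted_sup_comparison d hR hα hαR (half_pos hs').le
      set c := ENNReal.ofReal (1 + α⁻¹) with hc
      -- The mass handles the lattice point 0, about which `T` says nothing for `s > 0`; the second
      -- term handles the others.
      set A : ℝ≥0∞ := μ Set.univ + T ^ (1 / 2 : ℝ) * c ^ ((s : ℝ) / 2) with hA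
      have hAfin : A ≠ ∞ := by
        have h1 : T ^ (1 / 2 : ℝ) ≠ ∞ := ENNReal.rpow_ne_top_of_nonneg (by norm_num) h.ne
        have h2 : c ^ ((s : ℝ) / 2) ≠ ∞ :=
          ENNReal.rpow_ne_top_of_nonneg (by positivity) ENNReal.ofReal_ne_top
        finiteness
      have hlat (k : Fin d → ℤ) : ‖measureFourier μ (scaledLatticePoint α k)‖ₑ *
          enormWeight (scaledLatticePoint α k) ^ ((s : ℝ) / 2) ≤ A := by
        rcases eq_or_ne k 0 with rfl | hk
        · simp only [scaledLatticePoint_zero, enormWeight, enorm_zero, add_zero, ENNReal.one_rpow,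
            mul_one]
          exact (hbdd 0).trans le_self_add
        · have h1 : ‖measureFourier μ (scaledLatticePoint α k)‖ₑ ^ (2 : ℝ) *
              ‖scaledLatticePoint α k‖ₑ ^ (s : ℝ) ≤ T :=
            le_iSup₂_of_le (f := fun (z : EuclideanSpace ℝ (Fin d)) (_ : z ∈ scaledLattice d α) =>
              ‖measureFourier μ z‖ₑ ^ (2 : ℝ) * ‖z‖ₑ ^ (s : ℝ)) (scaledLatticePoint α k) ⟨k, rfl⟩
              le_rfl
          have h2 := ENNReal.rpow_le_rpow h1 (show (0 : ℝ) ≤ 1 / 2 by norm_num)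
          rw [ENNReal.mul_rpow_of_nonneg _ _ (by norm_num), ← ENNReal.rpow_mul,
            ← ENNReal.rpow_mul, mul_one_div_cancel two_ne_zero, ENNReal.rpow_one,
            mul_one_div] at h2
          have h3 := ENNReal.rpow_le_rpow (enormWeight_le_enorm_mul hα
            (le_norm_scaledLatticePoint hα hk)) (half_pos hs').le
          rw [ENNReal.mul_rpow_of_nonneg _ _ (half_pos hs').le] at h3
          calc _ ≤ ‖measureFourier μ (scaledLatticePoint α k)‖ₑ *
                (‖scaledLatticePoint α k‖ₑ ^ ((s : ℝ) / 2) * c ^ ((s : ℝ) / 2)) := by gcongr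
            _ = ‖measureFourier μ (scaledLatticePoint α k)‖ₑ *
                ‖scaledLatticePoint α k‖ₑ ^ ((s : ℝ) / 2) * c ^ ((s : ℝ) / 2) := by ring
            _ ≤ T ^ (1 / 2 : ℝ) * c ^ ((s : ℝ) / 2) := by gcongr
            _ ≤ A := le_add_self
      have hall := hM μ hμ hdiam A hlat
      have hAM : A * M ≠ ∞ := by finiteness
      -- The added 1 keeps the constant positive, so that at `z = 0` the right side is `∞` and not
      -- `0 * ∞ = 0`.
      refine ⟨(A * M).toNNReal + 1, by positivity, fun z => ?_⟩
      have h1 : ‖measureFourier μ z‖ₑ * ‖z‖ₑ ^ ((s : ℝ) / 2) ≤ A * M :=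
        le_trans (by gcongr; exact enorm_le_enormWeight z) (hall z)
      rcases eq_or_ne z 0 with rfl | hz
      · rw [enorm_zero, ENNReal.zero_rpow_of_neg (by linarith [half_pos hs']), ENNReal.mul_top]
        · exact le_top
        · exact_mod_cast (by positivity : ((A * M).toNNReal + 1) ≠ 0)
      · have hz0 : ‖z‖ₑ ≠ 0 := by simpa using hz
        rw [ENNReal.rpow_neg, ← div_eq_mul_inv, ENNReal.le_div_iff_mul_le]
        · rw [ENNReal.coe_add, ENNReal.coe_toNNReal hAM]
          exact h1.trans le_self_add
        · exact Or.inl (by simp [ENNReal.rpow_eq_zero_iff, hz0])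
        · exact Or.inl (ENNReal.rpow_ne_top_of_nonneg (half_pos hs').le enorm_ne_top)
  -- Here negative `s` cannot be used: the origin belongs to the lattice and `0 ^ s = ∞`, while the
  -- mass is positive. The value `s = 0` is always admissible.
  · refine le_sSup ⟨0, ?_, rfl⟩
    refine lt_of_le_of_lt (iSup₂_le (a := μ Set.univ ^ (2 : ℝ)) fun z _ => ?_) (by finiteness)
    rw [ENNReal.rpow_zero, mul_one]
    exact ENNReal.rpow_le_rpow (hbdd z) zero_le_two

theorem mainTheorem2 (d : ℕ) (R α : ℝ) (hR : 0 < R) (hα : 0 < α) (hαR : α < 1 / R) :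
    (∀ s : ℝ, 0 < s → ∃ C : ℝ≥0, 0 < C ∧
      ∀ (μ : Measure (EuclideanSpace ℝ (Fin d))) [IsFiniteMeasure μ],
        IsCompact μ.support → Metric.diam μ.support = R →
        ∀ θ : ℝ, 0 < θ → θ ≤ 1 →
          fourierEnergy s θ μ ≤ (C : ℝ≥0∞) * latticeEnergy α s θ μ ∧
          latticeEnergy α s θ μ ≤ (C : ℝ≥0∞) * fourierEnergy s θ μ) ∧
    (∀ (μ : Measure (EuclideanSpace ℝ (Fin d))) [IsFiniteMeasure μ],
      IsCompact μ.support → Metric.diam μ.support = R →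
        (∀ θ : ℝ, 0 < θ → θ ≤ 1 →
          ((fourierSpectrum θ μ : ℝ≥0∞) : EReal) =
            sSup ((fun s : ℝ => (s : EReal)) '' {s : ℝ | latticeSum α s θ μ < ∞})) ∧
        ((fourierDimension μ : ℝ≥0∞) : EReal) =
          sSup ((fun s : ℝ => (s : EReal)) ''
            {s : ℝ | (⨆ z ∈ scaledLattice d α,
              ‖measureFourier μ z‖ₑ ^ (2 : ℝ) * ‖z‖ₑ ^ s) < ∞})) := by
  rcases Nat.eq_zero_or_pos d with rfl | hd
  -- In dimension 0 every diameter is 0, so no measure qualifies.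
  · have hno (μ : Measure (EuclideanSpace ℝ (Fin 0))) : Metric.diam μ.support ≠ R := by
      rw [Metric.diam_subsingleton Set.subsingleton_of_subsingleton]
      exact hR.ne
    exact ⟨fun s _ => ⟨1, one_pos, fun μ _ _ hdiam => absurd hdiam (hno μ)⟩,
      fun μ _ _ hdiam => absurd hdiam (hno μ)⟩
  · exact ⟨fun s hs => exists_fourierEnergy_comparison hd hR hα hαR hs,
      fun μ _ hμ hdiam => ⟨fun θ hθ hθ1 =>
        fourierSpectrum_eq_sSup_latticeSum hd hR hα hαR μ hμ hdiam hθ hθ1,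
        fourierDimension_eq_sSup_lattice hR hα hαR μ hμ hdiam⟩⟩
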